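/- Let $Q$ be a finite-dimensional smooth ($C^\infty$, without boundary) manifold with a symplectic form $\omega$, i.e. a smooth, closed, nondegenerate differential 2-form. Let $\Gamma$ be a compact Lie group acting smoothly on $Q$ such that $\omega$ is $\Gamma$-invariant: for every $g\in\Gamma$ the diffeomorphism $\Phi_g : Q\to Q$, $\Phi_g(x)=g\cdot x$, satisfies $\Phi_g^*\omega=\omega$. Let $q\in Q$ be a fixed point of the action, $g\cdot q=q$ for all $g\in\Gamma$, and let $\Gamma$ act on the tangent space $T_qQ$ by the linearized action $g\cdot v = T_q\Phi_g(v)$. Regard $T_qQ$ as a symplectic vector space with the constant symplectic form $\omega(q)$. Then there are an open $\Gamma$-invariant neighborhood $U\subset Q$ of $q$, an open $\Gamma$-invariant neighborhood $V\subset T_qQ$ of $0$, and a $\Gamma$-equivariant symplectic diffeomorphism $f:(U,\omega)\to(V,\omega(q))$ with $f(q)=0$. That is, $f:U\to V$ is a smooth bijection with smooth inverse, $f(g\cdot x)=g\cdot f(x)$ for all $g\in\Gamma$ and $x\in U$, and $\omega(q)\big(T_xf\,v,\,T_xf\,w\big)=\omega(x)(v,w)$ for all $x\in U$ and $v,w\in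 T_xQ$. -/

import Mathlib

open scoped Manifold ContDiff

noncomputable section

namespace EquivariantDarboux

variable {E : Type*} [NormedAddCommGroup E] [NormedSpace ℝ E]
  {Q : Type*} [TopologicalSpace Q] [ChartedSpace E Q]

/-- A (not necessarily smooth) differential 2-form on the manifold `Q`. -/
abbrev TwoForm (E : Type*) [NormedAddCommGroup E] [NormedSpace ℝ E]
    (Q : Type*) [TopologicalSpace Q] [ChartedSpace E Q] : Type _ :=
  (x : Q) → TangentSpace 𝓘(ℝ, E) x [⋀^Fin 2]→L[ℝ] ℝ

/-- The coordinate expression of a 2-form in a chart `e`: its pullback along `e⁻¹`.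
It is meaningful on `e.target` only. -/
def TwoForm.inChart (Ω : TwoForm E Q) (e : OpenPartialHomeomorph Q E) (y : E) :
    E [⋀^Fin 2]→L[ℝ] ℝ :=
  (Ω (e.symm y)).compContinuousLinearMap (mfderiv 𝓘(ℝ, E) 𝓘(ℝ, E) e.symm y)

/-- A symplectic form: a smooth, closed, nondegenerate 2-form. Smoothness and closedness are
expressed in all smooth charts. -/
structure TwoForm.IsSymplectic (Ω : TwoForm E Q) : Prop where
  smooth : ∀ e ∈ IsManifold.maximalAtlas 𝓘(ℝ, E) ∞ Q, ContDiffOn ℝ ∞ (Ω.inChart e) e.target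
  closed : ∀ e ∈ IsManifold.maximalAtlas 𝓘(ℝ, E) ∞ Q, ∀ y ∈ e.target,
    extDeriv (Ω.inChart e) y = 0
  nondegenerate : ∀ (x : Q) (v : TangentSpace 𝓘(ℝ, E) x), (∀ w, Ω x ![v, w] = 0) → v = 0

/-- The differential at `x` of the diffeomorphism `x ↦ g • x`. -/
def smulDeriv {Γ : Type*} [SMul Γ Q] (g : Γ) (x : Q) :
    TangentSpace 𝓘(ℝ, E) x →L[ℝ] TangentSpace 𝓘(ℝ, E) (g • x) :=
  mfderiv 𝓘(ℝ, E) 𝓘(ℝ, E) (fun y : Q => g • y) x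

/-- `Ω` is invariant under the action of `Γ`: every `g` pulls `Ω` back to itself. -/
def TwoForm.IsInvariant (Γ : Type*) [SMul Γ Q] (Ω : TwoForm E Q) : Prop :=
  ∀ (g : Γ) (x : Q), (Ω (g • x)).compContinuousLinearMap (smulDeriv g x) = Ω x

/-- The identity map between the tangent spaces at two equal points. -/
def tangentCast {x y : Q} (h : x = y) :
    TangentSpace 𝓘(ℝ, E) x →L[ℝ] TangentSpace 𝓘(ℝ, E) y :=
  h ▸ ContinuousLinearMap.id ℝ (TangentSpace 𝓘(ℝ, E) x)

/-- The linearized action of `Γ` on the tangent space at a fixed point `q`. -/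
def linearizedAction {Γ : Type*} [SMul Γ Q] {q : Q} (hq : ∀ g : Γ, g • q = q) (g : Γ) :
    TangentSpace 𝓘(ℝ, E) q →L[ℝ] TangentSpace 𝓘(ℝ, E) q :=
  (tangentCast (hq g)).comp (smulDeriv g q)

/-- A linear homeomorphism between `T_q Q` and the model space. It provides the
vector space `T_q Q` with its smooth structure (any other one gives the same structure). -/
def tangentModel (q : Q) : TangentSpace 𝓘(ℝ, E) q ≃L[ℝ] E :=
  ContinuousLinearEquiv.refl ℝ E

/-- The differential at `x` of a map `f` from `Q` to the vector space `T_q Q`, where the tangent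
spaces of `T_q Q` are identified with `T_q Q` itself. -/
def vectorDeriv {q : Q} (f : Q → TangentSpace 𝓘(ℝ, E) q) (x : Q) :
    TangentSpace 𝓘(ℝ, E) x →L[ℝ] TangentSpace 𝓘(ℝ, E) q :=
  (tangentModel (E := E) q).symm.toContinuousLinearMap.comp
    ((NormedSpace.fromTangentSpace (𝕜 := ℝ) (tangentModel q (f x))).toContinuousLinearMap.comp
      (mfderiv 𝓘(ℝ, E) 𝓘(ℝ, E) (fun z => tangentModel q (f z)) x))

/-- `f` is a symplectic diffeomorphism from the open set `f.source` of `(Q, Ω)` onto the open set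
`f.target` of the vector space `T_q Q` with the constant form `Ω(q)`. -/
structure IsSymplectomorphismToTangent (Ω : TwoForm E Q) {q : Q}
    (f : OpenPartialHomeomorph Q (TangentSpace 𝓘(ℝ, E) q)) : Prop where
  smooth : ContMDiffOn 𝓘(ℝ, E) 𝓘(ℝ, E) ∞ (fun x => tangentModel q (f x)) f.source
  smooth_symm : ContMDiffOn 𝓘(ℝ, E) 𝓘(ℝ, E) ∞ (fun y : E => f.symm ((tangentModel q).symm y))
    ((tangentModel q).symm ⁻¹' f.target)
  pullback : ∀ x ∈ f.source, (Ω q).compContinuousLinearMap (vectorDeriv f x) = Ω x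

end EquivariantDarboux

end

open EquivariantDarboux

open scoped Manifold ContDiff
open Set Filter Topology MeasureTheory Function

set_option linter.unusedSectionVars false
set_option maxSynthPendingDepth 3

noncomputable section

namespace EquivariantDarboux

-- Bochner averaging reduces the statement to a linear action (`exists_linearizing_chart`): if `y`
-- is a chart vanishing at `q` and `ρ` the isotropy representation, the Haar average of `ρ g ∘ y ∘
-- g⁻¹` is an equivariant map whose derivative at `q`, relative to `y`, is the identity. Compactness
-- also bounds all `ρ g` uniformly, which replaces an invariant inner product.
--
-- On the linear side Moser's method applies (`exists_equivariant_moser`). Join the form `β` to its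
-- value `b = β 0` by `ω_t = β + t (b - β)`, choose `α` with `dα = b - β` and solve `ω_t(X_t, ·) =
-- -α`. The flow `φ_t` of `X_t` keeps `φ_t^* ω_t` constant, so `φ_1^* b = β`. The radial primitive
-- commutes with linear maps, so `α` inherits the invariance of `β`, and `X_t` and its flow are
-- equivariant. Since `b - β` vanishes at `0`, `α` and `X_t` vanish there to second order; hence the
-- flow exists up to time one near `0` and has derivative the identity at `0`.
--
-- Differentiation under the integral sign and smooth dependence of the flow on the initial point
-- both rest on `contDiff_superposition`: composing pointwise with a smooth family is a smooth
-- operator on `C(K, E)`. The flow comes from the inverse function theorem for the integral equation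
-- in `C([0, 1], E)`.

universe u v

/-! ### Smoothness of superposition operators on spaces of continuous maps. -/

section Superposition

variable {K : Type v} [TopologicalSpace K] [CompactSpace K]
  {E F : Type u} [NormedAddCommGroup E] [NormedSpace ℝ E] [NormedAddCommGroup F] [NormedSpace ℝ F]

/-- The superposition (Nemytskii) operator `u ↦ (k ↦ f k (u k))` on continuous maps. -/
def superposition (f : K → E → F) (hf : Continuous (uncurry f)) (w : C(K, E)) : C(K, F) :=
  ⟨fun k => f k (w k), hf.comp (continuous_id.prodMk w.continuous)⟩

@[simp] lemma superposition_apply (f : K → E → F) (hf : Continuous (uncurry f)) (w : C(K, E))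
    (k : K) : superposition f hf w k = f k (w k) := rfl

lemma continuous_superposition (f : K → E → F) (hf : Continuous (uncurry f)) :
    Continuous (superposition f hf) := by
  refine ContinuousMap.continuous_of_continuous_uncurry _ ?_
  exact hf.comp (continuous_snd.prodMk continuous_eval)

/-- Pointwise application of a continuous family of linear maps, as a continuous linear map. -/
def pointwiseApply : C(K, E →L[ℝ] F) →L[ℝ] C(K, E) →L[ℝ] C(K, F) :=
  LinearMap.mkContinuous₂
    (LinearMap.mk₂ ℝ (fun (A : C(K, E →L[ℝ] F)) (w : C(K, E)) =>
        (⟨fun k => A k (w k), A.continuous.clm_apply w.continuous⟩ : C(K, F)))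
      (fun _ _ _ => by ext; simp) (fun _ _ _ => by ext; simp)
      (fun _ _ _ => by ext; simp) (fun _ _ _ => by ext; simp)) 1 (by
    intro A w
    rw [ContinuousMap.norm_le _ (by positivity), one_mul]
    intro k
    exact (A k).le_of_opNorm_le_of_le (A.norm_coe_le_norm k) (w.norm_coe_le_norm k))

@[simp] lemma pointwiseApply_apply (A : C(K, E →L[ℝ] F)) (w : C(K, E)) (k : K) :
    pointwiseApply A w k = A k (w k) := rfl

/-- The mean value inequality bounds the remainder at each `k`. The bound is uniform in `k` because
the superposition operator of the derivatives is continuous in the sup norm, and the ball around `w`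
is convex. -/
lemma hasFDerivAt_superposition (f : K → E → F) (hf : Continuous (uncurry f))
    (hd : ∀ k, Differentiable ℝ (f k))
    (hf' : Continuous (uncurry fun k x => fderiv ℝ (f k) x)) (w : C(K, E)) :
    HasFDerivAt (superposition f hf)
      (pointwiseApply (superposition (fun k x => fderiv ℝ (f k) x) hf' w)) w := by
  rw [hasFDerivAt_iff_isLittleO, Asymptotics.isLittleO_iff]
  intro c hc
  have hcont := (continuous_superposition (fun k x => fderiv ℝ (f k) x) hf').tendsto w
  obtain ⟨δ, hδ, hball⟩ := Metric.mem_nhds_iff.1 (hcont (Metric.closedBall_mem_nhds _ hc))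
  filter_upwards [Metric.ball_mem_nhds w hδ] with z hz
  rw [ContinuousMap.norm_le _ (by positivity)]
  intro k
  have key : ∀ y ∈ segment ℝ (w k) (z k),
      ‖fderiv ℝ (f k) y - fderiv ℝ (f k) (w k)‖ ≤ c := by
    intro y hy
    rw [segment_eq_image_lineMap] at hy
    obtain ⟨θ, hθ, rfl⟩ := hy
    have hmem : AffineMap.lineMap w z θ ∈ Metric.ball w δ :=
      (convex_ball w δ).lineMap_mem (Metric.mem_ball_self hδ) hz hθ
    have h1 := hball hmem
    simp only [mem_preimage, Metric.mem_closedBall, dist_eq_norm] at h1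
    have h2 := ((superposition (fun k x => fderiv ℝ (f k) x) hf' (AffineMap.lineMap w z θ)
      - superposition (fun k x => fderiv ℝ (f k) x) hf' w).norm_coe_le_norm k).trans h1
    simpa [AffineMap.lineMap_apply] using h2
  have := (convex_segment (w k) (z k)).norm_image_sub_le_of_norm_hasFDerivWithin_le'
    (fun y _ => ((hd k) y).hasFDerivAt.hasFDerivWithinAt) key
    (left_mem_segment ℝ _ _) (right_mem_segment ℝ _ _)
  simp only [ContinuousMap.sub_apply, superposition_apply, pointwiseApply_apply]
  refine this.trans ?_
  gcongr
  exact (z - w).norm_coe_le_norm k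

variable {G : Type*} [NormedAddCommGroup G] [NormedSpace ℝ G] {H : Type*} [TopologicalSpace H]
  {J : ModelWithCorners ℝ G H} [ChartedSpace H K] [IsManifold J 1 K]

lemma contMDiff_fderiv_snd {f : K → E → F}
    (hf : ContMDiff (J.prod 𝓘(ℝ, E)) 𝓘(ℝ, F) ∞ (uncurry f)) :
    ContMDiff (J.prod 𝓘(ℝ, E)) 𝓘(ℝ, E →L[ℝ] F) ∞ (uncurry fun k x => fderiv ℝ (f k) x) := by
  intro p
  have h1 : ContMDiffAt ((J.prod 𝓘(ℝ, E)).prod 𝓘(ℝ, E)) 𝓘(ℝ, F) ∞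
      (uncurry fun (p : K × E) (y : E) => f p.1 y) (p, p.2) := by
    have : ContMDiff ((J.prod 𝓘(ℝ, E)).prod 𝓘(ℝ, E)) (J.prod 𝓘(ℝ, E)) ∞
        (fun r : (K × E) × E => (r.1.1, r.2)) :=
      (contMDiff_fst.comp contMDiff_fst).prodMk contMDiff_snd
    exact (hf.comp this).contMDiffAt
  have h2 := ContMDiffAt.mfderiv (m := ∞) (fun (p : K × E) (y : E) => f p.1 y) Prod.snd h1
    contMDiffAt_snd (by simp)
  have h3 := inTangentCoordinates_model_space (I := 𝓘(ℝ, E)) (I' := 𝓘(ℝ, F)) (Prod.snd : K × E → E)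
    (fun p : K × E => f p.1 p.2) (fun p => fderiv ℝ (f p.1) p.2) p
  simp only [mfderiv_eq_fderiv] at h2
  have h4 := h3 ▸ h2
  exact h4

lemma contDiff_of_contMDiff_uncurry {f : K → E → F}
    (hf : ContMDiff (J.prod 𝓘(ℝ, E)) 𝓘(ℝ, F) ∞ (uncurry f)) (k : K) : ContDiff ℝ ∞ (f k) := by
  rw [← contMDiff_iff_contDiff]
  exact hf.comp (contMDiff_const.prodMk contMDiff_id)

theorem contDiff_superposition {f : K → E → F}
    (hf : ContMDiff (J.prod 𝓘(ℝ, E)) 𝓘(ℝ, F) ∞ (uncurry f)) :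
    ContDiff ℝ ∞ (superposition f hf.continuous) := by
  rw [contDiff_infty]
  intro n
  -- The derivative is a fixed linear map after the superposition operator of `fderiv ℝ (f k)`, so
  -- the hypothesis is applied with `E →L[ℝ] F` for `F`; this is why `E` and `F` share a universe.
  induction n generalizing F with
  | zero => exact contDiff_zero.2 (continuous_superposition f hf.continuous)
  | succ n ih =>
    have hD := contMDiff_fderiv_snd hf
    have hderiv := hasFDerivAt_superposition f hf.continuous
      (fun k => (contDiff_of_contMDiff_uncurry hf k).differentiable (by simp)) hD.continuous
    push_cast
    rw [contDiff_succ_iff_fderiv]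
    refine ⟨fun w => (hderiv w).differentiableAt, by simp, ?_⟩
    have : fderiv ℝ (superposition f hf.continuous) =
        pointwiseApply ∘ superposition (fun k x => fderiv ℝ (f k) x) hD.continuous :=
      funext fun w => (hderiv w).fderiv
    rw [this]
    exact (pointwiseApply (K := K) (E := E) (F := F)).contDiff.comp (ih hD)

end Superposition

/-! ### Integrals depending smoothly on a parameter. -/

section Integral

variable {K : Type v} [TopologicalSpace K] [CompactSpace K] [MeasurableSpace K] [BorelSpace K]
  {E F : Type u} [NormedAddCommGroup E] [NormedSpace ℝ E] [NormedAddCommGroup F] [NormedSpace ℝ F]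
  (μ : Measure K) [IsFiniteMeasure μ]

lemma integrable_continuousMap (w : C(K, F)) : Integrable w μ :=
  w.continuous.integrable_of_hasCompactSupport (HasCompactSupport.of_compactSpace w)

/-- Integration against a finite measure on a compact space, as a continuous linear map. -/
def integralCLM : C(K, F) →L[ℝ] F :=
  LinearMap.mkContinuous
    { toFun := fun w => ∫ k, w k ∂μ
      map_add' := fun w z => integral_add (integrable_continuousMap μ w)
        (integrable_continuousMap μ z)
      map_smul' := fun c w => integral_smul c _ } (μ.real univ) (fun w => by
    rw [mul_comm]
    exact norm_integral_le_of_norm_le_const (Eventually.of_forall w.norm_coe_le_norm))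

variable {G : Type*} [NormedAddCommGroup G] [NormedSpace ℝ G] {H : Type*} [TopologicalSpace H]
  {J : ModelWithCorners ℝ G H} [ChartedSpace H K] [IsManifold J 1 K]

/-- Constant maps, as a continuous linear map. -/
def constCLM (K : Type v) [TopologicalSpace K] [CompactSpace K] : E →L[ℝ] C(K, E) :=
  LinearMap.mkContinuous
    { toFun := ContinuousMap.const K
      map_add' := fun _ _ => rfl
      map_smul' := fun _ _ => rfl } 1 (fun x => by
    rw [one_mul, ContinuousMap.norm_le _ (norm_nonneg x)]
    exact fun _ => le_rfl)

@[simp] lemma constCLM_apply (x : E) (k : K) : constCLM K x k = x := rfl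

/-- The integral factors as constant maps, then superposition, then integration; the outer two are
continuous linear. -/
theorem contDiff_integral {f : K → E → F}
    (hf : ContMDiff (J.prod 𝓘(ℝ, E)) 𝓘(ℝ, F) ∞ (uncurry f)) :
    ContDiff ℝ ∞ (fun x => ∫ k, f k x ∂μ) :=
  (integralCLM μ).contDiff.comp ((contDiff_superposition hf).comp (constCLM K).contDiff)

theorem hasFDerivAt_integral {f : K → E → F} [CompleteSpace F]
    (hf : ContMDiff (J.prod 𝓘(ℝ, E)) 𝓘(ℝ, F) ∞ (uncurry f)) (x : E) :
    HasFDerivAt (fun x => ∫ k, f k x ∂μ) (∫ k, fderiv ℝ (f k) x ∂μ) x := by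
  have hD := contMDiff_fderiv_snd hf
  have h1 := hasFDerivAt_superposition f hf.continuous
      (fun k => (contDiff_of_contMDiff_uncurry hf k).differentiable (by simp)) hD.continuous
      (constCLM K x)
  have h2 := (integralCLM μ).hasFDerivAt.comp x
    (h1.comp x (constCLM (E := E) K).hasFDerivAt)
  refine h2.congr_fderiv ?_
  ext v
  have hInt := integrable_continuousMap μ
    (superposition (fun k x => fderiv ℝ (f k) x) hD.continuous (constCLM K x))
  exact (ContinuousLinearMap.integral_apply hInt v).symm

end Integral

/-! ### Cutting off smooth families. -/

section Cutoff

variable {K : Type v} [TopologicalSpace K]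
  {E F : Type u} [NormedAddCommGroup E] [NormedSpace ℝ E] [FiniteDimensional ℝ E]
  [NormedAddCommGroup F] [NormedSpace ℝ F]
  {G : Type*} [NormedAddCommGroup G] [NormedSpace ℝ G] {H : Type*} [TopologicalSpace H]
  {J : ModelWithCorners ℝ G H} [ChartedSpace H K]

/-- A family of maps which is smooth near `y` agrees near `y` with a globally smooth family. -/
lemma exists_contMDiff_eqOn {f : K → E → F} {W : Set E} {y : E} (hW : W ∈ 𝓝 y)
    (hf : ContMDiffOn (J.prod 𝓘(ℝ, E)) 𝓘(ℝ, F) ∞ (uncurry f) (univ ×ˢ W)) :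
    ∃ f' : K → E → F, ContMDiff (J.prod 𝓘(ℝ, E)) 𝓘(ℝ, F) ∞ (uncurry f') ∧
      ∃ r > 0, Metric.ball y r ⊆ W ∧ ∀ k, ∀ x ∈ Metric.ball y r, f' k x = f k x := by
  obtain ⟨R, hR, hRW⟩ := Metric.mem_nhds_iff.1 hW
  -- The support radius `R / 2` is less than `R`, so the open ball of radius `R`, where `f` is
  -- smooth, and the open set where `χ` vanishes identically cover `E`.
  let χ : ContDiffBump y := ⟨R / 4, R / 2, by positivity, by linarith⟩
  refine ⟨fun k x => χ x • f k x, ?_, R / 4, by positivity,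
    (Metric.ball_subset_ball (by linarith)).trans hRW, fun k x hx => ?_⟩
  · rintro ⟨k, x⟩
    have hχ : ContMDiff (J.prod 𝓘(ℝ, E)) 𝓘(ℝ, ℝ) ∞ (fun p : K × E => χ p.2) :=
      χ.contDiff.contMDiff.comp contMDiff_snd
    by_cases hx : x ∈ Metric.ball y R
    · have : univ ×ˢ W ∈ 𝓝 (k, x) :=
        prod_mem_nhds univ_mem (mem_of_superset (Metric.isOpen_ball.mem_nhds hx) hRW)
      exact (hχ.contMDiffAt).smul (hf.contMDiffAt this)
    · have hx' : x ∈ (Metric.closedBall y (R / 2))ᶜ := by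
        simp only [Metric.mem_ball, not_lt, mem_compl_iff, Metric.mem_closedBall, not_le] at hx ⊢
        linarith
      have hev : (uncurry fun (k : K) (x : E) => χ x • f k x) =ᶠ[𝓝 (k, x)] fun _ => 0 := by
        filter_upwards [prod_mem_nhds univ_mem (Metric.isClosed_closedBall.isOpen_compl.mem_nhds hx')]
          with p hp
        have : R / 2 ≤ dist p.2 y := by
          have := hp.2
          simp only [mem_compl_iff, Metric.mem_closedBall, not_le] at this
          exact this.le
        simp [uncurry, χ.zero_of_le_dist this]
      exact contMDiffAt_const.congr_of_eventuallyEq hev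
  · dsimp only
    rw [χ.one_of_mem_closedBall (Metric.ball_subset_closedBall hx), one_smul]

end Cutoff

/-! ### The inverse function theorem. -/

section Inverse

variable {E F : Type*} [NormedAddCommGroup E] [NormedSpace ℝ E] [CompleteSpace E]
  [NormedAddCommGroup F] [NormedSpace ℝ F]

/-- The inverse function theorem, with a smooth inverse on the whole target. -/
lemma exists_openPartialHomeomorph_contDiffOn {f : E → F} {W : Set E} {a : E} (hW : IsOpen W)
    (ha : a ∈ W) (hf : ContDiffOn ℝ ∞ f W) (f' : E ≃L[ℝ] F)
    (hf' : HasFDerivAt f (f' : E →L[ℝ] F) a) :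
    ∃ P : OpenPartialHomeomorph E F, a ∈ P.source ∧ P.source ⊆ W ∧ ⇑P = f ∧
      ContDiffOn ℝ ∞ P.symm P.target := by
  have hfa : ContDiffAt ℝ ∞ f a := hf.contDiffAt (hW.mem_nhds ha)
  let P₀ := hfa.toOpenPartialHomeomorph f hf' (by simp)
  have hcont : ContinuousOn (fderiv ℝ f) W := hf.continuousOn_fderiv_of_isOpen hW (by simp)
  -- Invertibility of the derivative is an open condition; imposing it on the source makes the
  -- inverse smooth at every point of the target.
  let S := W ∩ fderiv ℝ f ⁻¹' range ((↑) : (E ≃L[ℝ] F) → E →L[ℝ] F)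
  have hS : IsOpen S := hcont.isOpen_inter_preimage hW (ContinuousLinearEquiv.isOpen)
  have haS : a ∈ S := ⟨ha, f', hf'.fderiv.symm⟩
  refine ⟨P₀.restrOpen S hS, ⟨hfa.mem_toOpenPartialHomeomorph_source hf' (by simp), haS⟩,
    fun x hx => hx.2.1, rfl, fun y hy => ?_⟩
  set P := P₀.restrOpen S hS
  have hx : P.symm y ∈ P.source := P.map_target hy
  obtain ⟨A, hA⟩ := hx.2.2
  have hfx : ContDiffAt ℝ ∞ f (P.symm y) := hf.contDiffAt (hW.mem_nhds hx.2.1)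
  have hder : HasFDerivAt f (A : E →L[ℝ] F) (P.symm y) := by
    rw [hA]
    exact (hfx.differentiableAt (by simp)).hasFDerivAt
  exact (P.contDiffAt_symm hy hder hfx).contDiffWithinAt

end Inverse

/-! ### The radial Poincaré lemma. -/

section Primitive

variable {E : Type u} [NormedAddCommGroup E] [NormedSpace ℝ E]

lemma contMDiff_uncurry_Icc {F : Type u} [NormedAddCommGroup F] [NormedSpace ℝ F]
    {f : ℝ → E → F} {W : Set E}
    (hf : ContDiffOn ℝ ∞ (uncurry f) (Icc 0 1 ×ˢ W)) :
    ContMDiffOn ((𝓡∂ 1).prod 𝓘(ℝ, E)) 𝓘(ℝ, F) ∞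
      (uncurry fun (t : Icc (0 : ℝ) 1) x => f t x) (univ ×ˢ W) := by
  have h1 : ContMDiff ((𝓡∂ 1).prod 𝓘(ℝ, E)) 𝓘(ℝ, ℝ × E) ∞
      (fun p : Icc (0 : ℝ) 1 × E => ((p.1 : ℝ), p.2)) :=
    (contMDiff_subtypeVal_Icc.comp contMDiff_fst).prodMk_space contMDiff_snd
  exact hf.contMDiffOn.comp h1.contMDiffOn (fun p hp => ⟨p.1.2, hp.2⟩)

lemma integral_Icc_eq_intervalIntegral {F : Type*} [NormedAddCommGroup F] [NormedSpace ℝ F]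
    (f : ℝ → F) : ∫ t : Icc (0 : ℝ) 1, f t = ∫ t in (0 : ℝ)..1, f t := by
  have h : ∫ t : Icc (0 : ℝ) 1, f t = ∫ t in Icc (0 : ℝ) 1, f t :=
    integral_subtype_comap measurableSet_Icc f
  rw [h, integral_Icc_eq_integral_Ioc,
    intervalIntegral.integral_of_le zero_le_one]

variable [FiniteDimensional ℝ E]

/-- The Poincaré lemma for 2-forms near `0`, with the radial primitive. -/
theorem exists_radial_primitive {s : E → E →L[ℝ] E →L[ℝ] ℝ} {W : Set E} (hW : W ∈ 𝓝 (0 : E))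
    (hs : ContDiffOn ℝ ∞ s W) (hanti : ∀ x ∈ W, ∀ v w, s x v w = - s x w v)
    (hclosed : ∀ x ∈ W, ∀ v₁ v₂ v₃,
      fderiv ℝ s x v₁ v₂ v₃ - fderiv ℝ s x v₂ v₁ v₃ + fderiv ℝ s x v₃ v₁ v₂ = 0)
    (hs0 : s 0 = 0) :
    ∃ α : E → E →L[ℝ] ℝ, ContDiff ℝ ∞ α ∧ ∃ r > 0, Metric.ball 0 r ⊆ W ∧
      (∀ x ∈ Metric.ball 0 r, ∀ v, α x v = ∫ t in (0 : ℝ)..1, t * s (t • x) x v) ∧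
      (∀ x ∈ Metric.ball 0 r, ∀ v w, fderiv ℝ α x v w - fderiv ℝ α x w v = s x v w) ∧
      α 0 = 0 ∧ fderiv ℝ α 0 = 0 := by
  obtain ⟨s', hs', r, hr, hrW, hss'⟩ : ∃ s' : E → E →L[ℝ] E →L[ℝ] ℝ, ContDiff ℝ ∞ s' ∧
      ∃ r > 0, Metric.ball 0 r ⊆ W ∧ ∀ x ∈ Metric.ball (0 : E) r, s' x = s x := by
    obtain ⟨f', hf', r, hr, hrW, h⟩ := exists_contMDiff_eqOn (J := 𝓡∂ 1) hW
      (contMDiff_uncurry_Icc (f := fun _ x => s x) (hs.comp contDiffOn_snd fun p hp => hp.2))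
    exact ⟨f' 0, contDiff_of_contMDiff_uncurry hf' 0, r, hr, hrW, h 0⟩
  let f : ℝ → E → E →L[ℝ] ℝ := fun t x => t • s' (t • x) x
  have hf : ContDiff ℝ ∞ (uncurry f) := by
    have : ContDiff ℝ ∞ (fun p : ℝ × E => s' (p.1 • p.2)) :=
      hs'.comp (contDiff_fst.smul contDiff_snd)
    exact contDiff_fst.smul (this.clm_apply contDiff_snd)
  have hfM := contMDiff_uncurry_Icc (W := univ) hf.contDiffOn
  rw [univ_prod_univ, contMDiffOn_univ] at hfM
  have hds : ∀ x, HasFDerivAt s' (fderiv ℝ s' x) x := fun x =>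
    (hs'.differentiable (by simp) x).hasFDerivAt
  have hfd : ∀ (t : ℝ) (x v : E), fderiv ℝ (f t) x v =
      t • (t • fderiv ℝ s' (t • x) v x + s' (t • x) v) := by
    intro t x v
    have h1 : HasFDerivAt (fun x : E => s' (t • x))
        ((fderiv ℝ s' (t • x)).comp (t • ContinuousLinearMap.id ℝ E)) x :=
      HasFDerivAt.comp (f := fun x : E => t • x) x (hds (t • x)) ((hasFDerivAt_id x).const_smul t)
    have h2 := (h1.clm_apply (hasFDerivAt_id x)).const_smul t
    have h3 : fderiv ℝ (f t) x = _ := h2.fderiv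
    rw [h3]
    ext w
    simp
    ring
  have hα := hasFDerivAt_integral (μ := (volume : Measure (Icc (0 : ℝ) 1))) hfM
  have hInt : ∀ g : ℝ → E →L[ℝ] ℝ, Continuous g → ∀ v,
      (∫ t : Icc (0 : ℝ) 1, g t) v = ∫ t in (0 : ℝ)..1, g t v := by
    intro g hg v
    rw [ContinuousLinearMap.integral_apply, integral_Icc_eq_intervalIntegral (fun t => g t v)]
    exact integrable_continuousMap volume ⟨fun t : Icc (0 : ℝ) 1 => g t, by fun_prop⟩
  have hc1 : ∀ x v, Continuous fun t : ℝ => fderiv ℝ s' (t • x) v := fun x v =>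
    ((hs'.continuous_fderiv (by simp)).comp (continuous_id.smul continuous_const)).clm_apply
      continuous_const
  have hc2 : ∀ x v, Continuous fun t : ℝ => s' (t • x) v := fun x v =>
    (hs'.continuous.comp (continuous_id.smul continuous_const)).clm_apply continuous_const
  have hfdc : ∀ x v, Continuous fun t => fderiv ℝ (f t) x v := by
    intro x v
    simp only [hfd]
    exact continuous_id.smul ((continuous_id.smul ((hc1 x v).clm_apply continuous_const)).add
      (hc2 x v))
  have hfdi : ∀ x v w, IntervalIntegrable
      (fun t : ℝ => t * (t * fderiv ℝ s' (t • x) v x w + s' (t • x) v w)) volume 0 1 :=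
    fun x v w => Continuous.intervalIntegrable (continuous_id.mul ((continuous_id.mul
      (((hc1 x v).clm_apply continuous_const).clm_apply continuous_const)).add
        ((hc2 x v).clm_apply continuous_const))) _ _
  have hαd : ∀ x v w, (∫ t : Icc (0 : ℝ) 1, fderiv ℝ (f t) x) v w =
      ∫ t in (0 : ℝ)..1, t * (t * fderiv ℝ s' (t • x) v x w + s' (t • x) v w) := by
    intro x v w
    have hD := contMDiff_fderiv_snd hfM
    have h1 : (∫ t : Icc (0 : ℝ) 1, fderiv ℝ (f t) x) v = ∫ t : Icc (0 : ℝ) 1, fderiv ℝ (f t) x v :=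
      ContinuousLinearMap.integral_apply (integrable_continuousMap volume
        (superposition _ hD.continuous (constCLM _ x))) v
    rw [h1, hInt (fun t => fderiv ℝ (f t) x v) (hfdc x v)]
    simp [hfd, mul_add]
  have hball : ∀ x ∈ Metric.ball (0 : E) r, ∀ t ∈ Icc (0 : ℝ) 1, t • x ∈ Metric.ball (0 : E) r := by
    intro x hx t ht
    rw [mem_ball_zero_iff] at hx ⊢
    rw [norm_smul, Real.norm_of_nonneg ht.1]
    exact lt_of_le_of_lt (mul_le_of_le_one_left (norm_nonneg _) ht.2) hx
  have hfderiv_eq : ∀ x ∈ Metric.ball (0 : E) r, fderiv ℝ s' x = fderiv ℝ s x := fun x hx =>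
    Filter.EventuallyEq.fderiv_eq (by
      filter_upwards [Metric.isOpen_ball.mem_nhds hx] with y hy using hss' y hy)
  refine ⟨fun x => ∫ t : Icc (0 : ℝ) 1, f t x, contDiff_integral volume hfM, r, hr, hrW,
    fun x hx v => ?_, fun x hx v w => ?_, ?_, ?_⟩
  · dsimp only
    rw [hInt (fun t => f t x) (hf.continuous.comp (continuous_id.prodMk continuous_const))]
    refine intervalIntegral.integral_congr fun t ht => ?_
    rw [uIcc_of_le zero_le_one] at ht
    simp [f, hss' _ (hball x hx t ht)]
  · rw [(hα x).fderiv, hαd, hαd, ← intervalIntegral.integral_sub]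
    -- Closedness and antisymmetry turn the difference of the integrands into the derivative of `t²
    -- s(tx)(v, w)`, which is `s x v w` at `1` and zero at `0`.
    · have hderiv : ∀ t ∈ uIcc (0 : ℝ) 1, HasDerivAt (fun t : ℝ => t ^ 2 * s' (t • x) v w)
          (t * (t * fderiv ℝ s' (t • x) v x w + s' (t • x) v w) -
            t * (t * fderiv ℝ s' (t • x) w x v + s' (t • x) w v)) t := by
        intro t ht
        rw [uIcc_of_le zero_le_one] at ht
        have hm := hball x hx t ht
        have h1 : HasDerivAt (fun t : ℝ => s' (t • x)) (fderiv ℝ s' (t • x) x) t := by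
          have h0 : HasDerivAt (fun t : ℝ => t • x) x t := by
            simpa using (hasDerivAt_id t).smul_const x
          exact (hds (t • x)).comp_hasDerivAt t h0
        have h2 : HasDerivAt (fun t : ℝ => s' (t • x) v w) (fderiv ℝ s' (t • x) x v w) t := by
          have := (h1.clm_apply (hasDerivAt_const t v)).clm_apply (hasDerivAt_const t w)
          simpa using this
        have h3 := (hasDerivAt_pow 2 t).mul h2
        refine h3.congr_deriv ?_
        have hc := hclosed (t • x) (hrW hm) x v w
        have ha := hanti (t • x) (hrW hm) v w
        rw [hfderiv_eq _ hm, hss' _ hm]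
        push_cast
        linear_combination t ^ 2 * hc + t * ha
      rw [intervalIntegral.integral_eq_sub_of_hasDerivAt hderiv]
      · simp [hss' x hx]
      · exact (hfdi x v w).sub (hfdi x w v)
    · exact hfdi x v w
    · exact hfdi x w v
  · simp [f]
  · rw [(hα 0).fderiv]
    ext v w
    rw [hαd]
    simp [hss' 0 (Metric.mem_ball_self hr), hs0]

end Primitive

/-! ### Flows from the inverse function theorem. -/

section Flow

variable {E : Type u} [NormedAddCommGroup E] [NormedSpace ℝ E] [CompleteSpace E]

lemma continuous_IccExtend (w : C(Icc (0 : ℝ) 1, E)) :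
    Continuous (IccExtend (zero_le_one' ℝ) w) := w.continuous.Icc_extend'

/-- The Volterra operator `w ↦ (t ↦ ∫₀ᵗ w)` on `C([0, 1], E)`. -/
def volterra : C(Icc (0 : ℝ) 1, E) →L[ℝ] C(Icc (0 : ℝ) 1, E) :=
  LinearMap.mkContinuous
    { toFun := fun w => ⟨fun t => ∫ s in (0 : ℝ)..t, IccExtend (zero_le_one' ℝ) w s,
        (intervalIntegral.continuous_primitive
          (fun a b => (continuous_IccExtend w).intervalIntegrable a b) 0).comp
          continuous_subtype_val⟩
      map_add' := fun w z => by
        ext t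
        exact intervalIntegral.integral_add ((continuous_IccExtend w).intervalIntegrable _ _)
          ((continuous_IccExtend z).intervalIntegrable _ _)
      map_smul' := fun c w => by
        ext t
        exact intervalIntegral.integral_smul c _ } 1 (fun w => by
    rw [one_mul, ContinuousMap.norm_le _ (norm_nonneg w)]
    intro t
    have h := intervalIntegral.norm_integral_le_of_norm_le_const (a := (0 : ℝ)) (b := t)
      (f := IccExtend (zero_le_one' ℝ) w) (C := ‖w‖) (fun s _ => w.norm_coe_le_norm _)
    refine h.trans (mul_le_of_le_one_right (norm_nonneg w) ?_)
    rw [sub_zero, abs_of_nonneg t.2.1]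
    exact t.2.2)

lemma volterra_apply (w : C(Icc (0 : ℝ) 1, E)) (t : Icc (0 : ℝ) 1) :
    volterra w t = ∫ s in (0 : ℝ)..t, IccExtend (zero_le_one' ℝ) w s := rfl

/-- A solution of `w = x + ∫ z` extends to a differentiable curve with derivative `z`. -/
lemma exists_curve_of_eq_volterra {w z : C(Icc (0 : ℝ) 1, E)} {x : E}
    (h : w = constCLM _ x + volterra z) :
    ∃ c : ℝ → E, c 0 = x ∧ (∀ t : Icc (0 : ℝ) 1, c t = w t) ∧
      ∀ t : Icc (0 : ℝ) 1, HasDerivAt c (z t) t := by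
  -- The constant extension of `z` beyond `[0, 1]` makes the derivative two-sided at the endpoints
  -- too.
  refine ⟨fun t => x + ∫ s in (0 : ℝ)..t, IccExtend (zero_le_one' ℝ) z s, by simp, fun t => ?_,
    fun t => ?_⟩
  · rw [h]
    rfl
  · have := (intervalIntegral.integral_hasDerivAt_right
      ((continuous_IccExtend z).intervalIntegrable 0 (t : ℝ))
      ((continuous_IccExtend z).stronglyMeasurableAtFilter _ _)
      (continuous_IccExtend z).continuousAt).const_add x
    rwa [IccExtend_val] at this

/-- The integral curves of a time-dependent vector field which vanishes to second order at `0`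
depend smoothly on the initial value. -/
theorem exists_smooth_flow {X : Icc (0 : ℝ) 1 → E → E}
    (hX : ContMDiff ((𝓡∂ 1).prod 𝓘(ℝ, E)) 𝓘(ℝ, E) ∞ (uncurry X))
    (hX0 : ∀ t, X t 0 = 0) (hX0' : ∀ t, fderiv ℝ (X t) 0 = 0) :
    ∃ U : E → C(Icc (0 : ℝ) 1, E), ∃ δ > 0, ∃ ε > 0, ContDiffOn ℝ ∞ U (Metric.ball 0 δ) ∧
      U 0 = 0 ∧ HasFDerivAt U (constCLM _) 0 ∧
      (∀ x ∈ Metric.ball 0 δ,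
        U x = constCLM _ x + volterra (superposition X hX.continuous (U x))) ∧
      (∀ w x, ‖w‖ < ε → w = constCLM _ x + volterra (superposition X hX.continuous w) →
        w = U x) := by
  -- Integral curves from `x` are the solutions of `H w = x`, with `x` read as a constant map.
  -- Second-order vanishing of `X` gives `H' 0 = id`, so `U` is the local inverse of `H` on
  -- constants.
  let H : C(Icc (0 : ℝ) 1, E) → C(Icc (0 : ℝ) 1, E) :=
    fun w => w - volterra (superposition X hX.continuous w)
  have hH : ContDiff ℝ ∞ H :=
    contDiff_id.sub ((volterra (E := E)).contDiff.comp (contDiff_superposition hX))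
  have hN0 : superposition X hX.continuous 0 = 0 := by
    ext t
    simp [hX0]
  have hH0 : H 0 = 0 := by simp [H, hN0]
  have hH' : HasFDerivAt H ((ContinuousLinearEquiv.refl ℝ C(Icc (0 : ℝ) 1, E) :
      C(Icc (0 : ℝ) 1, E) →L[ℝ] C(Icc (0 : ℝ) 1, E))) 0 := by
    have h1 := hasFDerivAt_superposition X hX.continuous
      (fun k => (contDiff_of_contMDiff_uncurry hX k).differentiable (by simp))
      (contMDiff_fderiv_snd hX).continuous 0
    have h2 := (hasFDerivAt_id (0 : C(Icc (0 : ℝ) 1, E))).sub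
      ((volterra (E := E)).hasFDerivAt.comp 0 h1)
    refine h2.congr_fderiv ?_
    have h3 : superposition (fun k x => fderiv ℝ (X k) x) (contMDiff_fderiv_snd hX).continuous
        (0 : C(Icc (0 : ℝ) 1, E)) = 0 := by
      ext t : 1
      simp [hX0']
    rw [h3]
    ext w : 1
    simp
  obtain ⟨P, h0P, -, hPH, hPs⟩ := exists_openPartialHomeomorph_contDiffOn isOpen_univ (mem_univ 0)
    hH.contDiffOn _ hH'
  have hP0 : P 0 = 0 := by rw [hPH, hH0]
  have h0T : (0 : C(Icc (0 : ℝ) 1, E)) ∈ P.target := hP0 ▸ P.map_source h0P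
  have hPs0 : P.symm 0 = 0 := by
    have := P.left_inv h0P
    rwa [hP0] at this
  obtain ⟨ε, hε, hεP⟩ := Metric.isOpen_iff.1 P.open_source 0 h0P
  have hpre : (constCLM (E := E) (Icc (0 : ℝ) 1)) ⁻¹' P.target ∈ 𝓝 0 :=
    (constCLM (E := E) (Icc (0 : ℝ) 1)).continuous.continuousAt.preimage_mem_nhds
      (by rw [map_zero]; exact P.open_target.mem_nhds h0T)
  obtain ⟨δ, hδ, hδP⟩ := Metric.mem_nhds_iff.1 hpre
  refine ⟨fun x => P.symm (constCLM _ x), δ, hδ, ε, hε, ?_, by simp [hPs0], ?_, ?_, ?_⟩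
  · exact hPs.comp (constCLM (E := E) (Icc (0 : ℝ) 1)).contDiff.contDiffOn hδP
  · have hd : HasFDerivAt P.symm _ 0 := P.hasFDerivAt_symm h0T (by
      rw [hPs0, hPH]
      exact hH')
    have hd' := HasFDerivAt.comp (f := constCLM (E := E) (Icc (0 : ℝ) 1)) (0 : E)
      (by rw [map_zero]; exact hd) (constCLM (E := E) (Icc (0 : ℝ) 1)).hasFDerivAt
    exact hd'
  · intro x hx
    have h := P.right_inv (hδP hx)
    rw [hPH] at h
    exact sub_eq_iff_eq_add.1 h
  · intro w x hw h
    have hw' : w ∈ P.source := hεP (by simpa using hw)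
    have h1 : P w = constCLM _ x := by
      rw [hPH]
      exact sub_eq_iff_eq_add.2 h
    dsimp only
    rw [← h1, P.left_inv hw']

end Flow

/-! ### Moser's identity along an integral curve. -/

section MoserIdentity

variable {E : Type u} [NormedAddCommGroup E] [NormedSpace ℝ E]

/-- The segment of 2-forms from `β` to the constant form `b`. -/
def moserPath (β : E → E →L[ℝ] E →L[ℝ] ℝ) (b : E →L[ℝ] E →L[ℝ] ℝ) (t : ℝ) (x : E) :
    E →L[ℝ] E →L[ℝ] ℝ := β x + t • (b - β x)

variable {β : E → E →L[ℝ] E →L[ℝ] ℝ} {b : E →L[ℝ] E →L[ℝ] ℝ} {t : ℝ} {X : E → E}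
  {α : E → E →L[ℝ] ℝ} {x : E}

lemma fderiv_of_moserPath_eq (hβ : DifferentiableAt ℝ β x) (hX : DifferentiableAt ℝ X x)
    (hα : DifferentiableAt ℝ α x)
    (h : ∀ᶠ y in 𝓝 x, moserPath β b t y (X y) = - α y) (v w : E) :
    (1 - t) * fderiv ℝ β x v (X x) w + moserPath β b t x (fderiv ℝ X x v) w =
      - fderiv ℝ α x v w := by
  have hM : HasFDerivAt (moserPath β b t) (fderiv ℝ β x + t • (0 - fderiv ℝ β x)) x :=
    hβ.hasFDerivAt.add (((hasFDerivAt_const b x).sub hβ.hasFDerivAt).const_smul t)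
  have h1 := hM.clm_apply hX.hasFDerivAt
  have h2 := hα.hasFDerivAt.neg
  have h3 := h1.unique (h2.congr_of_eventuallyEq h)
  have h4 := congrArg (fun A => A v w) h3
  simp only [zero_sub, smul_neg, _root_.add_apply, ContinuousLinearMap.comp_apply,
    ContinuousLinearMap.flip_apply, _root_.neg_apply,
    _root_.smul_apply, smul_eq_mul] at h4
  linear_combination h4

/-- This is `d/dt (φ_t^* ω_t) = φ_t^* (b - β + d(ι_X ω_t)) = 0` evaluated on two vectors: `p` and
`q` satisfy the variational equation, as the derivative of the flow does. Differentiating `ω_t(X) =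
-α` in the directions `p t` and `q t` and antisymmetrizing gives `dα`, and closedness accounts for
the derivative of `β` along `X`. -/
lemma hasDerivAt_moserPath {c p q : ℝ → E} (hβ : DifferentiableAt ℝ β (c t))
    (hX : DifferentiableAt ℝ X (c t)) (hα : DifferentiableAt ℝ α (c t))
    (h : ∀ᶠ y in 𝓝 (c t), moserPath β b t y (X y) = - α y)
    (hβanti : ∀ v w, β (c t) v w = - β (c t) w v) (hbanti : ∀ v w, b v w = - b w v)
    (hclosed : ∀ v₁ v₂ v₃, fderiv ℝ β (c t) v₁ v₂ v₃ - fderiv ℝ β (c t) v₂ v₁ v₃ +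
      fderiv ℝ β (c t) v₃ v₁ v₂ = 0)
    (hdα : ∀ v w, fderiv ℝ α (c t) v w - fderiv ℝ α (c t) w v = b v w - β (c t) v w)
    (hc : HasDerivAt c (X (c t)) t) (hp : HasDerivAt p (fderiv ℝ X (c t) (p t)) t)
    (hq : HasDerivAt q (fderiv ℝ X (c t) (q t)) t) :
    HasDerivAt (fun τ => moserPath β b τ (c τ) (p τ) (q τ)) 0 t := by
  have h1 := hβ.hasFDerivAt.comp_hasDerivAt t hc
  have h2 := (h1.add ((hasDerivAt_id t).smul ((hasDerivAt_const t b).sub h1)))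
  have h3 := (h2.clm_apply hp).clm_apply hq
  refine h3.congr_deriv ?_
  have e1 := fderiv_of_moserPath_eq hβ hX hα h (p t) (q t)
  have e2 := fderiv_of_moserPath_eq hβ hX hα h (q t) (p t)
  have e3 := hclosed (X (c t)) (p t) (q t)
  have e4 := hdα (p t) (q t)
  have e5 := hβanti (p t) (fderiv ℝ X (c t) (q t))
  have e6 := hbanti (p t) (fderiv ℝ X (c t) (q t))
  simp only [moserPath, _root_.add_apply, _root_.smul_apply,
    _root_.sub_apply, smul_eq_mul] at e1 e2
  simp only [_root_.add_apply, _root_.smul_apply,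
    _root_.sub_apply, smul_eq_mul, Pi.add_apply, Pi.smul_apply', Pi.sub_apply,
    Function.comp_apply, id, zero_sub, one_smul, _root_.neg_apply]
  linear_combination e1 - e2 + (1 - t) * e3 - e4 + (1 - t) * e5 + t * e6

end MoserIdentity

/-! ### Equivariant Moser method on a vector space. -/

section Moser

variable {E : Type u} [NormedAddCommGroup E] [NormedSpace ℝ E] [FiniteDimensional ℝ E]
  {Γ : Type*} [Group Γ]

lemma isInvertible_of_nondegenerate {b : E →L[ℝ] E →L[ℝ] ℝ}
    (hb : ∀ v, (∀ w, b v w = 0) → v = 0) : b.IsInvertible := by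
  have hinj : Function.Injective (b : E →ₗ[ℝ] E →L[ℝ] ℝ) := by
    rw [← LinearMap.ker_eq_bot, LinearMap.ker_eq_bot']
    intro v hv
    exact hb v fun w => by simpa using congrArg (fun l : E →L[ℝ] ℝ => l w) hv
  have hdim : Module.finrank ℝ E = Module.finrank ℝ (E →L[ℝ] ℝ) := by
    rw [← Subspace.dual_finrank_eq (K := ℝ) (V := E)]
    exact (LinearMap.toContinuousLinearMap (𝕜 := ℝ) (E := E) (F' := ℝ)).finrank_eq
  refine ⟨(LinearMap.linearEquivOfInjective _ hinj hdim).toContinuousLinearEquiv, ?_⟩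
  ext v w
  rfl

/-- The vector field of the Moser method, together with its equivariance. -/
theorem exists_moser_vectorField (ρ : Γ →* (E →L[ℝ] E)) {β : E → E →L[ℝ] E →L[ℝ] ℝ} {W : Set E}
    (hW : IsOpen W) (h0 : 0 ∈ W) (hβ : ContDiffOn ℝ ∞ β W)
    (hanti : ∀ x ∈ W, ∀ v w, β x v w = - β x w v)
    (hclosed : ∀ x ∈ W, ∀ v₁ v₂ v₃,
      fderiv ℝ β x v₁ v₂ v₃ - fderiv ℝ β x v₂ v₁ v₃ + fderiv ℝ β x v₃ v₁ v₂ = 0)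
    (hnd : ∀ v, (∀ w, β 0 v w = 0) → v = 0)
    (hinv : ∀ g, ∀ x ∈ W, ρ g x ∈ W → ∀ v w, β (ρ g x) (ρ g v) (ρ g w) = β x v w) :
    ∃ (X : Icc (0 : ℝ) 1 → E → E) (α : E → E →L[ℝ] ℝ),
      ContMDiff ((𝓡∂ 1).prod 𝓘(ℝ, E)) 𝓘(ℝ, E) ∞ (uncurry X) ∧ ContDiff ℝ ∞ α ∧
      (∀ t, X t 0 = 0) ∧ (∀ t, fderiv ℝ (X t) 0 = 0) ∧
      ∃ r > 0, Metric.ball 0 r ⊆ W ∧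
        (∀ t : Icc (0 : ℝ) 1, ∀ x ∈ Metric.ball 0 r, moserPath β (β 0) t x (X t x) = - α x) ∧
        (∀ x ∈ Metric.ball 0 r, ∀ v w,
          fderiv ℝ α x v w - fderiv ℝ α x w v = β 0 v w - β x v w) ∧
        ∀ t g, ∀ x ∈ Metric.ball 0 r, ρ g x ∈ Metric.ball (0 : E) r →
          X t (ρ g x) = ρ g (X t x) := by
  have hdβ : ∀ x ∈ W, DifferentiableAt ℝ β x := fun x hx =>
    (hβ.contDiffAt (hW.mem_nhds hx)).differentiableAt (by simp)
  obtain ⟨α, hα, r₁, hr₁, hr₁W, hαint, hdα, hα0, hα0'⟩ :=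
    exists_radial_primitive (s := fun x => β 0 - β x) (hW.mem_nhds h0)
      (contDiffOn_const.sub hβ)
      (fun x hx v w => by
        have h1 := hanti x hx v w
        have h2 := hanti 0 h0 v w
        simp only [_root_.sub_apply]
        linarith)
      (fun x hx v₁ v₂ v₃ => by
        have h1 : fderiv ℝ (fun x => β 0 - β x) x = - fderiv ℝ β x := by
          rw [fderiv_const_sub]
        rw [h1]
        have h2 := hclosed x hx v₁ v₂ v₃
        simp only [_root_.neg_apply]
        linarith)
      (sub_self _)
  have hM : ContDiffOn ℝ ∞ (fun p : ℝ × E => moserPath β (β 0) p.1 p.2) (univ ×ˢ W) := by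
    have h1 : ContDiffOn ℝ ∞ (fun p : ℝ × E => β p.2) (univ ×ˢ W) :=
      hβ.comp contDiffOn_snd fun p hp => hp.2
    exact h1.add (contDiffOn_fst.smul (contDiffOn_const.sub h1))
  let S : Set (ℝ × E) := (univ ×ˢ W) ∩
    (fun p : ℝ × E => moserPath β (β 0) p.1 p.2) ⁻¹' range ((↑) : (E ≃L[ℝ] E →L[ℝ] ℝ) → _)
  have hS : IsOpen S :=
    hM.continuousOn.isOpen_inter_preimage (isOpen_univ.prod hW) ContinuousLinearEquiv.isOpen
  -- At the origin the path is constantly `β 0`, so it is invertible for every `t`; the tube lemma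
  -- makes this hold on one neighbourhood for all `t`.
  have hsub : Icc (0 : ℝ) 1 ×ˢ {(0 : E)} ⊆ S := by
    rintro ⟨t, x⟩ ⟨-, rfl⟩
    refine ⟨⟨mem_univ _, h0⟩, ?_⟩
    simp only [mem_preimage, moserPath, sub_self, smul_zero, add_zero]
    exact isInvertible_of_nondegenerate hnd
  obtain ⟨T, V, -, hV, hT, h0V, hTV⟩ :=
    generalized_tube_lemma isCompact_Icc isCompact_singleton hS hsub
  let X₀ : ℝ → E → E := fun t x => - (moserPath β (β 0) t x).inverse (α x)
  have hX₀ : ContDiffOn ℝ ∞ (uncurry X₀) (Icc 0 1 ×ˢ V) := by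
    rintro ⟨t, x⟩ ⟨ht, hx⟩
    obtain ⟨h1, A, hA⟩ := hTV (mk_mem_prod (hT ht) hx)
    have h2 : ContDiffAt ℝ ∞ (fun p : ℝ × E => moserPath β (β 0) p.1 p.2) (t, x) :=
      hM.contDiffAt ((isOpen_univ.prod hW).mem_nhds h1)
    have h3 : ContDiffAt ℝ ∞ (fun p : ℝ × E => (moserPath β (β 0) p.1 p.2).inverse) (t, x) := by
      refine ContDiffAt.comp (t, x) (g := ContinuousLinearMap.inverse) ?_ h2
      have := contDiffAt_map_inverse (𝕜 := ℝ) (n := ∞) A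
      rwa [hA] at this
    have h4 : ContDiffAt ℝ ∞ (fun p : ℝ × E => α p.2) (t, x) := (hα.comp contDiff_snd).contDiffAt
    exact (h3.clm_apply h4).neg.contDiffWithinAt
  -- The flow needs a globally smooth field; on a small ball the cutoff leaves Moser's equation
  -- intact.
  obtain ⟨X, hX, r₂, hr₂, hr₂V, hXX₀⟩ := exists_contMDiff_eqOn (J := 𝓡∂ 1)
    (hV.mem_nhds (h0V rfl)) (contMDiff_uncurry_Icc hX₀)
  set r := min r₁ r₂
  have hrr₁ : Metric.ball (0 : E) r ⊆ Metric.ball 0 r₁ := Metric.ball_subset_ball (min_le_left _ _)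
  have hrr₂ : Metric.ball (0 : E) r ⊆ Metric.ball 0 r₂ := Metric.ball_subset_ball (min_le_right _ _)
  have hr : 0 < r := lt_min hr₁ hr₂
  have hinvert : ∀ t : Icc (0 : ℝ) 1, ∀ x ∈ Metric.ball 0 r,
      (moserPath β (β 0) t x).IsInvertible := fun t x hx =>
    (hTV (mk_mem_prod (hT t.2) (hr₂V (hrr₂ hx)))).2
  have hmain : ∀ t : Icc (0 : ℝ) 1, ∀ x ∈ Metric.ball 0 r,
      moserPath β (β 0) t x (X t x) = - α x := by
    intro t x hx
    rw [hXX₀ t x (hrr₂ hx)]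
    obtain ⟨A, hA⟩ := hinvert t x hx
    simp [X₀, ← hA]
  have hinj : ∀ t : Icc (0 : ℝ) 1, ∀ x ∈ Metric.ball 0 r,
      Function.Injective (moserPath β (β 0) t x) := by
    intro t x hx
    obtain ⟨A, hA⟩ := hinvert t x hx
    rw [← hA]
    exact A.injective
  have h0r : (0 : E) ∈ Metric.ball 0 r := Metric.mem_ball_self hr
  have hX0 : ∀ t, X t 0 = 0 := fun t => hinj t 0 h0r (by rw [hmain t 0 h0r, hα0]; simp)
  refine ⟨X, α, hX, hα, hX0, fun t => ?_, r, hr, hrr₁.trans hr₁W, hmain,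
    fun x hx v w => ?_, fun t g x hx hgx => ?_⟩
  -- Differentiating `ω_t(X_t) = -α` at `0`, where `X_t` and `Dα` vanish, leaves `ω_t(DX_t v) = 0`.
  · ext v
    refine hinj t 0 h0r ?_
    ext w
    have := fderiv_of_moserPath_eq (hdβ 0 h0)
      ((contDiff_of_contMDiff_uncurry hX t).differentiable (by simp) 0)
      (hα.differentiable (by simp) 0)
      (by filter_upwards [Metric.isOpen_ball.mem_nhds h0r] with y hy using hmain t y hy) v w
    simpa [hX0, hα0'] using this
  · simpa using hdα x (hrr₁ hx) v w
  · have hβ0 : ∀ v w, β 0 (ρ g v) (ρ g w) = β 0 v w := by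
      simpa [h0] using hinv g 0 h0
    have hρ : ∀ w, ρ g (ρ g⁻¹ w) = w := fun w => by
      rw [← mul_apply_eq_comp, ← map_mul, mul_inv_cancel, map_one,
        one_apply_eq_self]
    have hinv' : ∀ y ∈ W, ρ g y ∈ W → ∀ v w, β (ρ g y) (ρ g v) w = β y v (ρ g⁻¹ w) := by
      intro y hy hgy v w
      rw [← hinv g y hy hgy, hρ]
    have hβ0' : ∀ v w, β 0 (ρ g v) w = β 0 v (ρ g⁻¹ w) := by
      intro v w
      rw [← hβ0 v, hρ]
    have hball : ∀ y ∈ Metric.ball (0 : E) r₁, ∀ τ ∈ Icc (0 : ℝ) 1,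
        τ • y ∈ Metric.ball (0 : E) r₁ := by
      intro y hy τ hτ
      rw [mem_ball_zero_iff] at hy ⊢
      rw [norm_smul, Real.norm_of_nonneg hτ.1]
      exact lt_of_le_of_lt (mul_le_of_le_one_left (norm_nonneg _) hτ.2) hy
    -- Linear maps carry rays to rays, so the invariance of `β` passes through the radial integral.
    have hα' : ∀ w, α (ρ g x) w = α x (ρ g⁻¹ w) := by
      intro w
      rw [hαint _ (hrr₁ hgx), hαint _ (hrr₁ hx)]
      refine intervalIntegral.integral_congr fun τ hτ => ?_
      rw [uIcc_of_le zero_le_one] at hτ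
      have h1 := hr₁W (hball x (hrr₁ hx) τ hτ)
      have h2 := hr₁W (hball _ (hrr₁ hgx) τ hτ)
      rw [← map_smul] at h2
      simp only [_root_.sub_apply, ← map_smul, hβ0']
      rw [hinv' _ h1 h2]
    refine hinj t _ hgx ?_
    rw [hmain t _ hgx]
    ext w
    have hm := congrArg (fun l : E →L[ℝ] ℝ => l (ρ g⁻¹ w)) (hmain t x hx)
    simp only [moserPath, _root_.add_apply, _root_.smul_apply, _root_.sub_apply,
      _root_.neg_apply] at hm ⊢
    rw [hα', ← hm, hinv' x (hr₁W (hrr₁ hx)) (hr₁W (hrr₁ hgx)), hβ0']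

/-- The equivariant Darboux theorem for a form near the origin of a vector space on which a group
acts by uniformly bounded linear maps. -/
theorem exists_equivariant_moser (ρ : Γ →* (E →L[ℝ] E)) {C : ℝ} (hC : ∀ g, ‖ρ g‖ ≤ C)
    {β : E → E →L[ℝ] E →L[ℝ] ℝ} {W : Set E}
    (hW : IsOpen W) (h0 : 0 ∈ W) (hβ : ContDiffOn ℝ ∞ β W)
    (hanti : ∀ x ∈ W, ∀ v w, β x v w = - β x w v)
    (hclosed : ∀ x ∈ W, ∀ v₁ v₂ v₃,
      fderiv ℝ β x v₁ v₂ v₃ - fderiv ℝ β x v₂ v₁ v₃ + fderiv ℝ β x v₃ v₁ v₂ = 0)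
    (hnd : ∀ v, (∀ w, β 0 v w = 0) → v = 0)
    (hinv : ∀ g, ∀ x ∈ W, ρ g x ∈ W → ∀ v w, β (ρ g x) (ρ g v) (ρ g w) = β x v w) :
    ∃ f : OpenPartialHomeomorph E E, 0 ∈ f.source ∧ f.source ⊆ W ∧ f 0 = 0 ∧
      ContDiffOn ℝ ∞ f f.source ∧ ContDiffOn ℝ ∞ f.symm f.target ∧
      (∀ g, ∀ x ∈ f.source, ρ g x ∈ f.source) ∧
      (∀ g, ∀ x ∈ f.source, f (ρ g x) = ρ g (f x)) ∧
      ∀ x ∈ f.source, ∀ v w, β 0 (fderiv ℝ f x v) (fderiv ℝ f x w) = β x v w := by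
  obtain ⟨X, α, hX, hα, hX0, hX0', r, hr, hrW, hXα, hdα, hXequiv⟩ :=
    exists_moser_vectorField ρ hW h0 hβ hanti hclosed hnd hinv
  obtain ⟨U, δ, hδ, ε, hε, hU, hU0, hU0', hUeq, hUuniq⟩ := exists_smooth_flow hX hX0 hX0'
  have hC0 : 0 ≤ C := (norm_nonneg _).trans (hC 1)
  have hρle : ∀ g x, ‖ρ g x‖ ≤ (C + 1) * ‖x‖ := fun g x =>
    ((ρ g).le_of_opNorm_le (hC g) x).trans (by gcongr; linarith)
  have hρinv : ∀ g x, ρ g⁻¹ (ρ g x) = x := fun g x => by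
    rw [← mul_apply_eq_comp, ← map_mul, inv_mul_cancel, map_one,
      one_apply_eq_self]
  -- a ball on which the curves stay small
  set η := min r ε / (C + 1) with hη
  have hη0 : 0 < η := by positivity
  have hηr : η ≤ min r ε := div_le_self (by positivity) (by linarith)
  obtain ⟨δ₁, hδ₁, hδ₁δ, hUη⟩ : ∃ δ₁ > 0, δ₁ ≤ δ ∧ ∀ x ∈ Metric.ball (0 : E) δ₁, ‖U x‖ < η := by
    have hcont : ContinuousAt U 0 := hU0'.continuousAt
    have hmem : {x | ‖U x‖ < η} ∈ 𝓝 (0 : E) := by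
      have := hcont.norm.eventually_lt (g := fun _ => η) continuousAt_const (by simpa [hU0])
      exact this
    obtain ⟨δ₁, hδ₁, h⟩ := Metric.mem_nhds_iff.1 hmem
    exact ⟨min δ δ₁, lt_min hδ hδ₁, min_le_left _ _,
      fun x hx => h (Metric.ball_subset_ball (min_le_right _ _) hx)⟩
  have hballδ : Metric.ball (0 : E) δ₁ ⊆ Metric.ball 0 δ := Metric.ball_subset_ball hδ₁δ
  have hCη : (C + 1) * η = min r ε := by
    rw [hη]
    field_simp
  have hequivU : ∀ g, ∀ x ∈ Metric.ball (0 : E) δ₁, ∀ t, U (ρ g x) t = ρ g (U x t) := by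
    intro g x hx t
    have hxU : ∀ t, ‖U x t‖ < η := fun t => ((U x).norm_coe_le_norm t).trans_lt (hUη x hx)
    have hgU : ∀ t, ‖ρ g (U x t)‖ < min r ε := fun t => by
      refine (hρle g _).trans_lt ?_
      rw [← hCη]
      gcongr
      exact hxU t
    let z : C(Icc (0 : ℝ) 1, E) := ⟨fun t => ρ g (U x t), by fun_prop⟩
    -- The translated curve solves the integral equation with initial value `ρ g x`, so uniqueness
    -- identifies it.
    have hz : z = U (ρ g x) := by
      refine hUuniq z (ρ g x) ?_ ?_
      · rw [ContinuousMap.norm_lt_iff _ hε]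
        exact fun t => (hgU t).trans_le (min_le_right _ _)
      · ext t
        have h1 : U x t = x + ∫ s in (0 : ℝ)..t,
            IccExtend (zero_le_one' ℝ) (superposition X hX.continuous (U x)) s := by
          conv_lhs => rw [hUeq x (hballδ hx)]
          rfl
        have h2 : z t = ρ g (U x t) := rfl
        rw [h2, h1, map_add, ← ContinuousLinearMap.intervalIntegral_comp_comm _
          ((continuous_IccExtend _).intervalIntegrable _ _)]
        have h3 : ∀ s, IccExtend (zero_le_one' ℝ) (superposition X hX.continuous z) s =
            ρ g (IccExtend (zero_le_one' ℝ) (superposition X hX.continuous (U x)) s) := by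
          intro s
          simp only [IccExtend, Function.comp_apply, superposition_apply]
          refine hXequiv _ g _ ?_ ?_
          · exact mem_ball_zero_iff.2 (((hxU _).trans_le hηr).trans_le (min_le_left _ _))
          · exact mem_ball_zero_iff.2 ((hgU _).trans_le (min_le_left _ _))
        simp only [← h3]
        rfl
    rw [← hz]
    rfl
  -- the time one map
  let ev : C(Icc (0 : ℝ) 1, E) →L[ℝ] E := ContinuousMap.evalCLM ℝ (1 : Icc (0 : ℝ) 1)
  have hf : ContDiffOn ℝ ∞ (fun x => U x 1) (Metric.ball 0 δ₁) :=
    ev.contDiff.comp_contDiffOn (hU.mono hballδ)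
  have hf' : HasFDerivAt (fun x => U x 1) (ContinuousLinearEquiv.refl ℝ E : E →L[ℝ] E) 0 :=
    (ev.hasFDerivAt.comp 0 hU0').congr_fderiv rfl
  obtain ⟨P, h0P, hPδ, hPf, hPsymm⟩ := exists_openPartialHomeomorph_contDiffOn
    Metric.isOpen_ball (Metric.mem_ball_self hδ₁) hf _ hf'
  obtain ⟨κ, hκ, hκP⟩ := Metric.isOpen_iff.1 P.open_source 0 h0P
  -- Saturating a ball gives an invariant set, and the factor `C + 1` keeps it inside the ball of
  -- radius `κ`.
  let V : Set E := ⋃ g, ρ g ⁻¹' Metric.ball 0 (κ / (C + 1))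
  have hVo : IsOpen V := isOpen_iUnion fun g => Metric.isOpen_ball.preimage (ρ g).continuous
  have hVP : V ⊆ P.source := by
    intro x hx
    obtain ⟨g, hg⟩ := mem_iUnion.1 hx
    refine hκP (mem_ball_zero_iff.2 ?_)
    have h1 := hρle g⁻¹ (ρ g x)
    rw [hρinv] at h1
    refine h1.trans_lt ?_
    have h2 : ‖ρ g x‖ < κ / (C + 1) := mem_ball_zero_iff.1 hg
    calc (C + 1) * ‖ρ g x‖ < (C + 1) * (κ / (C + 1)) := by gcongr
      _ = κ := by field_simp
  have hVinv : ∀ g, ∀ x ∈ V, ρ g x ∈ V := by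
    intro g x hx
    obtain ⟨h, hh⟩ := mem_iUnion.1 hx
    refine mem_iUnion.2 ⟨h * g⁻¹, ?_⟩
    simp only [mem_preimage, map_mul, mul_apply_eq_comp, hρinv]
    exact hh
  have h0V : (0 : E) ∈ V := mem_iUnion.2 ⟨1, by simp; positivity⟩
  let f := P.restrOpen V hVo
  have hfs : f.source = V := inter_eq_right.2 hVP
  have hfc : ⇑f = fun x => U x 1 := hPf
  have hVδ : V ⊆ Metric.ball 0 δ₁ := hVP.trans hPδ
  have hUsmall : ∀ x ∈ V, ∀ t, U x t ∈ Metric.ball (0 : E) r := fun x hx t =>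
    mem_ball_zero_iff.2 ((((U x).norm_coe_le_norm t).trans_lt (hUη x (hVδ hx))).trans_le
      (hηr.trans (min_le_left _ _)))
  refine ⟨f, hfs ▸ h0V, ?_, ?_, ?_, ?_, ?_, ?_, ?_⟩
  · rw [hfs]
    intro x hx
    have h1 := hUsmall x hx 0
    have h2 : U x 0 = x := by
      rw [hUeq x (hballδ (hVδ hx))]
      simp [volterra_apply]
    rw [h2] at h1
    exact hrW h1
  · rw [hfc]
    simp [hU0]
  · rw [hfs, hfc]
    exact hf.mono hVδ
  · exact hPsymm.mono fun y hy => hy.1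
  · rw [hfs]
    exact hVinv
  · rw [hfs, hfc]
    exact fun g x hx => hequivU g x (hVδ hx) 1
  · rw [hfs, hfc]
    intro x hx v w
    have hxδ : x ∈ Metric.ball (0 : E) δ := hballδ (hVδ hx)
    have hUx : HasFDerivAt U (fderiv ℝ U x) x :=
      ((hU.contDiffAt (Metric.isOpen_ball.mem_nhds hxδ)).differentiableAt (by simp)).hasFDerivAt
    have hfx : fderiv ℝ (fun x => U x 1) x = ev.comp (fderiv ℝ U x) :=
      (ev.hasFDerivAt.comp x hUx).fderiv
    have hDX := (contMDiff_fderiv_snd hX).continuous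
    have hXd : ∀ t, Differentiable ℝ (X t) := fun t =>
      (contDiff_of_contMDiff_uncurry hX t).differentiable (by simp)
    -- Differentiating the integral equation in `x` gives the variational equation in integral form.
    have hlin : ∀ v, fderiv ℝ U x v = constCLM _ v + volterra (pointwiseApply
        (superposition (fun k x => fderiv ℝ (X k) x) hDX (U x)) (fderiv ℝ U x v)) := by
      intro v
      have h1 := (constCLM (E := E) (Icc (0 : ℝ) 1)).hasFDerivAt (x := x) |>.add
        ((volterra (E := E)).hasFDerivAt.comp x
          ((hasFDerivAt_superposition X hX.continuous hXd hDX (U x)).comp x hUx))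
      have h2 := h1.congr_of_eventuallyEq (f₁ := U) (by
        filter_upwards [Metric.isOpen_ball.mem_nhds hxδ] with y hy using hUeq y hy)
      exact congrArg (fun A => A v) (hUx.unique h2)
    obtain ⟨c, hc0, hcU, hc⟩ := exists_curve_of_eq_volterra (hUeq x hxδ)
    obtain ⟨p, hp0, hpU, hp⟩ := exists_curve_of_eq_volterra (hlin v)
    obtain ⟨q, hq0, hqU, hq⟩ := exists_curve_of_eq_volterra (hlin w)
    have hderiv : ∀ t ∈ Icc (0 : ℝ) 1,
        HasDerivAt (fun τ => moserPath β (β 0) τ (c τ) (p τ) (q τ)) 0 t := by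
      intro t ht
      have hct := hcU ⟨t, ht⟩
      have hpt := hpU ⟨t, ht⟩
      have hqt := hqU ⟨t, ht⟩
      have hmem : c t ∈ Metric.ball (0 : E) r := hct ▸ hUsmall x hx ⟨t, ht⟩
      refine hasDerivAt_moserPath (X := X ⟨t, ht⟩) (α := α)
        ((hβ.contDiffAt (hW.mem_nhds (hrW hmem))).differentiableAt (by simp))
        (hXd _ _) (hα.differentiable (by simp) _) ?_ (hanti _ (hrW hmem)) (hanti 0 h0)
        (hclosed _ (hrW hmem)) (hdα _ hmem) ?_ ?_ ?_
      · filter_upwards [Metric.isOpen_ball.mem_nhds hmem] with y hy using hXα ⟨t, ht⟩ y hy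
      · rw [hct]
        exact hc ⟨t, ht⟩
      · rw [hct, hpt]
        exact hp ⟨t, ht⟩
      · rw [hct, hqt]
        exact hq ⟨t, ht⟩
    have hconst := constant_of_has_deriv_right_zero
      (fun t ht => (hderiv t ht).continuousAt.continuousWithinAt)
      (fun t ht => (hderiv t (Ico_subset_Icc_self ht)).hasDerivWithinAt) 1 ⟨zero_le_one, le_rfl⟩
    have hp1 : p 1 = fderiv ℝ U x v 1 := hpU 1
    have hq1 : q 1 = fderiv ℝ U x w 1 := hqU 1
    simp only [moserPath, hc0, hp0, hq0, hp1, hq1, one_smul, zero_smul, add_zero,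
      add_sub_cancel] at hconst
    rw [hfx]
    exact hconst

end Moser

/-! ### Bochner linearization at a fixed point. -/

section Linearization

variable {E : Type u} [NormedAddCommGroup E] [NormedSpace ℝ E]
  {Q : Type*} [TopologicalSpace Q] [ChartedSpace E Q] {Γ : Type v} [Group Γ] [MulAction Γ Q]

/-- The differential of `y ↦ g • y` at `x`, read in the model space. -/
def actionDeriv (g : Γ) (x : Q) : E →L[ℝ] E :=
  mfderiv 𝓘(ℝ, E) 𝓘(ℝ, E) (fun y : Q => g • y) x

lemma tangentCast_apply {x y : Q} (h : x = y) (v : TangentSpace 𝓘(ℝ, E) x) :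
    (tangentCast h v : E) = v := by
  subst h
  rfl

/-- The isotropy representation at a fixed point, on the model space. -/
def isotropyRep {q : Q} (hq : ∀ g : Γ, g • q = q)
    (hd : ∀ g : Γ, MDifferentiable 𝓘(ℝ, E) 𝓘(ℝ, E) (fun y : Q => g • y)) : Γ →* (E →L[ℝ] E) where
  toFun g := actionDeriv g q
  map_one' := by
    have h : (fun y : Q => (1 : Γ) • y) = id := funext fun y => one_smul Γ y
    unfold actionDeriv
    rw [h]
    exact mfderiv_id
  map_mul' g h := by
    have h1 : actionDeriv (g * h) q = (actionDeriv g (h • q)).comp (actionDeriv (E := E) h q) := by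
      have h2 := mfderiv_comp (I := 𝓘(ℝ, E)) (I' := 𝓘(ℝ, E)) (I'' := 𝓘(ℝ, E)) q
        (g := fun y : Q => g • y) (f := fun y : Q => h • y) (hd g (h • q)) (hd h q)
      have h3 : (fun y : Q => (g * h) • y) = (fun y : Q => g • y) ∘ fun y : Q => h • y :=
        funext fun y => mul_smul g h y
      unfold actionDeriv
      rw [h3]
      exact h2
    rw [h1, hq h]
    rfl

lemma linearizedAction_apply {q : Q} (hq : ∀ g : Γ, g • q = q)
    (hd : ∀ g : Γ, MDifferentiable 𝓘(ℝ, E) 𝓘(ℝ, E) (fun y : Q => g • y)) (g : Γ) (v : E) :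
    linearizedAction hq g v = isotropyRep hq hd g v :=
  tangentCast_apply (hq g) _

lemma isotropyRep_eq_fderiv {q : Q} (hq : ∀ g : Γ, g • q = q)
    (hd : ∀ g : Γ, MDifferentiable 𝓘(ℝ, E) 𝓘(ℝ, E) (fun y : Q => g • y)) (g : Γ) :
    isotropyRep hq hd g =
      fderiv ℝ (fun y => chartAt E q (g • (chartAt E q).symm y)) (chartAt E q q) := by
  have h : HasFDerivWithinAt (writtenInExtChartAt 𝓘(ℝ, E) 𝓘(ℝ, E) q fun y : Q => g • y)
      (isotropyRep hq hd g) (range 𝓘(ℝ, E)) (extChartAt 𝓘(ℝ, E) q q) :=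
    (hd g q).hasMFDerivAt.2
  simp only [mfld_simps, hasFDerivWithinAt_univ, writtenInExtChartAt, hq g] at h
  exact h.fderiv.symm

/-- The complement is the projection of a closed subset of `Γ × Q` along the compact factor, hence
closed. -/
lemma isOpen_setOf_forall_smul_mem [TopologicalSpace Γ] [CompactSpace Γ] [ContinuousSMul Γ Q]
    {S : Set Q} (hS : IsOpen S) : IsOpen {x : Q | ∀ g : Γ, g • x ∈ S} := by
  have h1 : IsClosed ((fun p : Γ × Q => p.1 • p.2) ⁻¹' Sᶜ) := hS.isClosed_compl.preimage continuous_smul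
  have h2 := isClosedMap_snd_of_compactSpace _ h1
  rw [← isOpen_compl_iff] at h2
  convert h2 using 1
  ext x
  simp

variable [FiniteDimensional ℝ E] [IsManifold 𝓘(ℝ, E) ∞ Q]
  [TopologicalSpace Γ] [CompactSpace Γ]

lemma exists_haar_probabilityMeasure [MeasurableSpace Γ] [BorelSpace Γ] [IsTopologicalGroup Γ] :
    ∃ μ : Measure Γ, IsProbabilityMeasure μ ∧ μ.IsMulLeftInvariant :=
  ⟨Measure.haarMeasure ⊤, ⟨Measure.haarMeasure_self⟩, inferInstance⟩

/-- Bochner's linearization theorem: near a fixed point there is a chart in which the action of a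
compact Lie group is the isotropy representation. -/
theorem exists_linearizing_chart (F : Type*) [NormedAddCommGroup F] [NormedSpace ℝ F]
    [ChartedSpace F Γ] [LieGroup 𝓘(ℝ, F) ∞ Γ] [ContMDiffSMul 𝓘(ℝ, F) 𝓘(ℝ, E) ∞ Γ Q] {q : Q} (hq : ∀ g : Γ, g • q = q)
    (hd : ∀ g : Γ, MDifferentiable 𝓘(ℝ, E) 𝓘(ℝ, E) (fun y : Q => g • y)) :
    (∃ C, ∀ g, ‖isotropyRep hq hd g‖ ≤ C) ∧
    ∃ e ∈ IsManifold.maximalAtlas 𝓘(ℝ, E) ∞ Q, q ∈ e.source ∧ e q = 0 ∧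
      (∀ g : Γ, ∀ x ∈ e.source, g • x ∈ e.source) ∧
      (∀ g : Γ, ∀ x ∈ e.source, e (g • x) = isotropyRep hq hd g (e x)) ∧
      fderiv ℝ (e ∘ (chartAt E q).symm) (chartAt E q q) = ContinuousLinearMap.id ℝ E := by
  set ρ := isotropyRep hq hd
  set e₀ := chartAt E q
  set y₀ := e₀ q
  have hqs : q ∈ e₀.source := mem_chart_source E q
  have hy₀ : y₀ ∈ e₀.target := e₀.map_source hqs
  have hsy₀ : e₀.symm y₀ = q := e₀.left_inv hqs
  have : ContinuousSMul Γ Q := ContMDiffSMul.continuousSMul (I := 𝓘(ℝ, F)) (I' := 𝓘(ℝ, E)) ∞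
  have : IsTopologicalGroup Γ := topologicalGroup_of_lieGroup 𝓘(ℝ, F) ∞
  have : IsManifold 𝓘(ℝ, F) ∞ Γ := inferInstance
  have : IsManifold 𝓘(ℝ, F) 1 Γ := IsManifold.of_le (n := ∞) (by simp)
  let _ : MeasurableSpace Γ := borel Γ
  have : BorelSpace Γ := ⟨rfl⟩
  obtain ⟨μ, hμ, hμl⟩ := exists_haar_probabilityMeasure (Γ := Γ)
  -- the action in the chart
  let Φ₀ : Γ → E → E := fun g y => e₀ (g • e₀.symm y)
  let S : Set Q := {x | ∀ g : Γ, g • x ∈ e₀.source}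
  have hS : IsOpen S := isOpen_setOf_forall_smul_mem e₀.open_source
  have hqS : q ∈ S := fun g => by rw [hq g]; exact hqs
  let W : Set E := e₀.target ∩ e₀.symm ⁻¹' S
  have hW : IsOpen W := e₀.isOpen_inter_preimage_symm hS
  have hy₀W : y₀ ∈ W := ⟨hy₀, by rw [mem_preimage, hsy₀]; exact hqS⟩
  have hΦ₀ : ContMDiffOn (𝓘(ℝ, F).prod 𝓘(ℝ, E)) 𝓘(ℝ, E) ∞ (uncurry Φ₀) (univ ×ˢ W) := by
    have h1 : ContMDiffOn (𝓘(ℝ, F).prod 𝓘(ℝ, E)) 𝓘(ℝ, E) ∞ (fun p : Γ × E => e₀.symm p.2)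
        (univ ×ˢ W) :=
      (contMDiffOn_chart_symm (I := 𝓘(ℝ, E)) (n := ∞) (x := q)).comp contMDiffOn_snd
        (fun p hp => hp.2.1)
    have h2 : ContMDiffOn (𝓘(ℝ, F).prod 𝓘(ℝ, E)) 𝓘(ℝ, E) ∞ (fun p : Γ × E => p.1 • e₀.symm p.2)
        (univ ×ˢ W) :=
      (contMDiff_smul (I := 𝓘(ℝ, F)) (I' := 𝓘(ℝ, E)) (n := ∞)).comp_contMDiffOn
        (contMDiffOn_fst.prodMk h1)
    exact (contMDiffOn_chart (I := 𝓘(ℝ, E)) (n := ∞) (x := q)).comp h2 (fun p hp => hp.2.2 p.1)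
  obtain ⟨Φ, hΦ, r, hr, hrW, hΦΦ₀⟩ := exists_contMDiff_eqOn (hW.mem_nhds hy₀W) hΦ₀
  have hρΦ : ∀ g, ρ g = fderiv ℝ (Φ g) y₀ := by
    intro g
    refine (isotropyRep_eq_fderiv hq hd g).trans (Filter.EventuallyEq.fderiv_eq ?_)
    filter_upwards [Metric.ball_mem_nhds y₀ hr] with y hy using (hΦΦ₀ g y hy).symm
  have hρ : ContMDiff 𝓘(ℝ, F) 𝓘(ℝ, E →L[ℝ] E) ∞ ρ := by
    have h1 : ⇑ρ = fun g => fderiv ℝ (Φ g) y₀ := funext hρΦ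
    rw [h1]
    exact (contMDiff_fderiv_snd hΦ).comp (contMDiff_id.prodMk contMDiff_const)
  have hρinv : ∀ g, (ρ g).comp (ρ g⁻¹) = ContinuousLinearMap.id ℝ E := fun g => by
    have : ρ g * ρ g⁻¹ = 1 := by rw [← map_mul, mul_inv_cancel, map_one]
    exact this
  refine ⟨?_, ?_⟩
  · obtain ⟨C, hC⟩ := isCompact_univ.exists_bound_of_continuousOn hρ.continuous.continuousOn
    exact ⟨C, fun g => hC g (mem_univ g)⟩
  -- the averaged chart
  let f : Γ → E → E := fun g y => ρ g (Φ g⁻¹ y - y₀)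
  have hf : ContMDiff (𝓘(ℝ, F).prod 𝓘(ℝ, E)) 𝓘(ℝ, E) ∞ (uncurry f) := by
    have h1 : ContMDiff (𝓘(ℝ, F).prod 𝓘(ℝ, E)) 𝓘(ℝ, E) ∞ (fun p : Γ × E => Φ p.1⁻¹ p.2 - y₀) :=
      (hΦ.comp (((contMDiff_inv 𝓘(ℝ, F) ∞).comp contMDiff_fst).prodMk contMDiff_snd)).sub
        contMDiff_const
    exact (hρ.comp contMDiff_fst).clm_apply h1
  let ψ : E → E := fun y => ∫ g, f g y ∂μ
  have hψ : ContDiff ℝ ∞ ψ := contDiff_integral μ hf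
  have hψ' : HasFDerivAt ψ ((ContinuousLinearEquiv.refl ℝ E : E ≃L[ℝ] E) : E →L[ℝ] E) y₀ := by
    refine (hasFDerivAt_integral μ hf y₀).congr_fderiv ?_
    -- Each averaged map already has derivative `ρ g ∘ ρ g⁻¹ = id`, and `μ` has total mass one.
    have h1 : ∀ g, fderiv ℝ (f g) y₀ = ContinuousLinearMap.id ℝ E := by
      intro g
      have h2 : HasFDerivAt (Φ g⁻¹) (ρ g⁻¹) y₀ := by
        rw [hρΦ]
        exact ((contDiff_of_contMDiff_uncurry hΦ g⁻¹).differentiable (by simp) y₀).hasFDerivAt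
      exact ((ρ g).hasFDerivAt.comp y₀ (h2.sub_const y₀)).fderiv.trans (hρinv g)
    simp [h1]
  have hψ0 : ψ y₀ = 0 := by
    have h1 : ∀ g, f g y₀ = 0 := fun g => by
      simp only [f]
      rw [hΦΦ₀ g⁻¹ y₀ (Metric.mem_ball_self hr)]
      simp only [Φ₀, hsy₀, hq, y₀, sub_self, map_zero]
    simp [ψ, h1]
  obtain ⟨P, hy₀P, hPr, hPψ, hPsymm⟩ := exists_openPartialHomeomorph_contDiffOn
    Metric.isOpen_ball (Metric.mem_ball_self hr) hψ.contDiffOn _ hψ'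
  let e₁ := e₀.trans P
  -- The largest invariant subset of the chart domain; it is open because `Γ` is compact.
  let T : Set Q := {x | ∀ g : Γ, g • x ∈ e₁.source}
  have hT : IsOpen T := isOpen_setOf_forall_smul_mem e₁.open_source
  have hTe : T ⊆ e₁.source := fun x hx => by simpa using hx 1
  let e := e₁.restrOpen T hT
  have hes : e.source = T := inter_eq_right.2 hTe
  have hec : ⇑e = fun x => ψ (e₀ x) := by
    change P ∘ e₀ = _
    rw [hPψ]
    rfl
  have hqT : q ∈ T := fun g => by
    rw [hq g]
    exact ⟨hqs, hy₀P⟩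
  have hTinv : ∀ g : Γ, ∀ x ∈ T, g • x ∈ T := fun g x hx h => by
    rw [← mul_smul]
    exact hx (h * g)
  have heint : ∀ x ∈ T, e x = ∫ g, ρ g (e₀ (g⁻¹ • x) - y₀) ∂μ := by
    intro x hx
    rw [hec]
    refine integral_congr_ae (Eventually.of_forall fun g => ?_)
    have h1 := hTe hx
    have h2 : e₀ x ∈ Metric.ball y₀ r := hPr h1.2
    simp only [f]
    rw [hΦΦ₀ _ _ h2]
    simp only [Φ₀, e₀.left_inv h1.1]
  have hemax : e ∈ IsManifold.maximalAtlas 𝓘(ℝ, E) ∞ Q := by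
    refine e.mem_maximalAtlas_of_contMDiffOn ?_ ?_
    · rw [hec]
      refine hψ.contMDiff.comp_contMDiffOn
        ((contMDiffOn_chart (I := 𝓘(ℝ, E)) (n := ∞) (x := q)).mono fun x hx => ?_)
      exact (hTe (hes ▸ hx)).1
    · refine (contMDiffOn_chart_symm (I := 𝓘(ℝ, E)) (n := ∞) (x := q)).comp
        (hPsymm.contMDiffOn.mono fun y hy => ?_) fun y hy => ?_
      · exact hy.1.1
      · exact hy.1.2
  refine ⟨e, hemax, hes ▸ hqT, ?_, ?_, ?_, ?_⟩
  · rw [hec]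
    exact hψ0
  · rw [hes]
    exact hTinv
  · rw [hes]
    intro h x hx
    -- Substituting `h * g` for `g` cancels `h` inside the chart and pulls `ρ h` out of the
    -- integral.
    rw [heint _ (hTinv h x hx), heint x hx, ← integral_mul_left_eq_self _ h,
      ← ContinuousLinearMap.integral_comp_comm]
    · refine integral_congr_ae (Eventually.of_forall fun g => ?_)
      simp only [mul_inv_rev, map_mul, mul_apply_eq_comp, mul_smul, inv_smul_smul]
    · have h1 : Continuous fun g : Γ => ρ g (e₀ (g⁻¹ • x) - y₀) := by
        refine hρ.continuous.clm_apply (Continuous.sub ?_ continuous_const)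
        exact e₀.continuousOn.comp_continuous (continuous_inv.smul continuous_const)
          (fun g => (hx g⁻¹).1)
      exact integrable_continuousMap μ ⟨_, h1⟩
  · have h1 : ⇑e ∘ e₀.symm =ᶠ[𝓝 y₀] ψ := by
      filter_upwards [e₀.open_target.mem_nhds hy₀] with y hy
      rw [hec]
      simp only [Function.comp_apply, e₀.right_inv hy]
    rw [h1.fderiv_eq, hψ'.fderiv]
    rfl

end Linearization

/-! ### Alternating 2-forms as bilinear maps. -/

section TwoForms

variable {E : Type u} [NormedAddCommGroup E] [NormedSpace ℝ E]

lemma update_pair_zero (v w z : E) : Function.update ![v, w] 0 z = ![z, w] := by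
  ext i
  fin_cases i <;> simp

lemma update_pair_one (v w z : E) : Function.update ![v, w] 1 z = ![v, z] := by
  ext i
  fin_cases i <;> simp

lemma norm_apply_pair_le (η : E [⋀^Fin 2]→L[ℝ] ℝ) (v w : E) : ‖η ![v, w]‖ ≤ ‖η‖ * ‖v‖ * ‖w‖ := by
  have := η.le_opNorm ![v, w]
  simpa [Fin.prod_univ_two, mul_assoc] using this

/-- An alternating 2-form as a bilinear map. -/
def alternatingToBilin : (E [⋀^Fin 2]→L[ℝ] ℝ) →L[ℝ] E →L[ℝ] E →L[ℝ] ℝ :=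
  LinearMap.mkContinuous
    { toFun := fun η : E [⋀^Fin 2]→L[ℝ] ℝ => LinearMap.mkContinuous₂
        (LinearMap.mk₂ ℝ (fun v w : E => η ![v, w])
        (fun v v' w => by
          have h := η.toMultilinearMap.map_update_add ![v, w] 0 v v'
          simp only [update_pair_zero] at h
          exact h)
        (fun c v w => by
          have h := η.toMultilinearMap.map_update_smul ![v, w] 0 c v
          simp only [update_pair_zero] at h
          exact h)
        (fun v w w' => by
          have h := η.toMultilinearMap.map_update_add ![v, w] 1 w w'
          simp only [update_pair_one] at h
          exact h)
        (fun c v w => by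
          have h := η.toMultilinearMap.map_update_smul ![v, w] 1 c w
          simp only [update_pair_one] at h
          exact h))
        ‖η‖ (norm_apply_pair_le η)
      map_add' := fun _ _ => rfl
      map_smul' := fun _ _ => rfl } 1 (fun η => by
    rw [one_mul]
    exact LinearMap.mkContinuous₂_norm_le _ (norm_nonneg η) (norm_apply_pair_le η))

lemma ext_pair {η θ : E [⋀^Fin 2]→L[ℝ] ℝ} (h : ∀ v w, η ![v, w] = θ ![v, w]) : η = θ := by
  ext m
  have hm : m = ![m 0, m 1] := by
    ext i
    fin_cases i <;> rfl
  rw [hm]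
  exact h _ _

lemma alternating_swap (η : E [⋀^Fin 2]→L[ℝ] ℝ) (v w : E) : η ![v, w] = - η ![w, v] := by
  have h := η.toAlternatingMap.map_swap ![w, v] (i := 0) (j := 1) (by simp)
  have h2 : ![w, v] ∘ Equiv.swap (0 : Fin 2) 1 = ![v, w] := by
    ext i
    fin_cases i <;> simp
  rw [h2] at h
  exact h

lemma fderiv_alternatingToBilin_comp {η : E → E [⋀^Fin 2]→L[ℝ] ℝ} {x : E}
    (hη : DifferentiableAt ℝ η x) (u v w : E) :
    fderiv ℝ (fun y => alternatingToBilin (η y)) x u v w = fderiv ℝ η x u ![v, w] := by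
  have h : HasFDerivAt (fun y => alternatingToBilin (η y)) _ x :=
    (alternatingToBilin (E := E)).hasFDerivAt.comp x hη.hasFDerivAt
  rw [h.fderiv]
  rfl

lemma fderiv_cyclic_of_extDeriv_eq_zero {η : E → E [⋀^Fin 2]→L[ℝ] ℝ} {x : E}
    (h : extDeriv η x = 0) (v₁ v₂ v₃ : E) :
    fderiv ℝ η x v₁ ![v₂, v₃] - fderiv ℝ η x v₂ ![v₁, v₃] + fderiv ℝ η x v₃ ![v₁, v₂] = 0 := by
  have h1 := congrArg (fun A => A ![v₁, v₂, v₃]) h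
  simp only [extDeriv, ContinuousAlternatingMap.alternatizeUncurryFin_apply] at h1
  replace h1 := (Fin.sum_univ_three (fun i : Fin 3 => (-1 : ℤ) ^ (i : ℕ) •
    fderiv ℝ η x (![v₁, v₂, v₃] i) (i.removeNth ![v₁, v₂, v₃]))).symm.trans h1
  have e0 : (0 : Fin 3).removeNth ![v₁, v₂, v₃] = ![v₂, v₃] := by
    ext i
    fin_cases i <;> rfl
  have e1 : (1 : Fin 3).removeNth ![v₁, v₂, v₃] = ![v₁, v₃] := by
    ext i
    fin_cases i <;> rfl
  have e2 : (2 : Fin 3).removeNth ![v₁, v₂, v₃] = ![v₁, v₂] := by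
    ext i
    fin_cases i <;> rfl
  rw [e0, e1, e2] at h1
  simp at h1
  linarith

end TwoForms

/-! ### Forms and group actions read in charts. -/

section Charts

variable {E : Type u} [NormedAddCommGroup E] [NormedSpace ℝ E]
  {Q : Type*} [TopologicalSpace Q] [ChartedSpace E Q] {Γ : Type v} [Group Γ] [MulAction Γ Q]

/-- The value of a 2-form at a point, read in the model space. -/
def TwoForm.atPoint (Ω : TwoForm E Q) (x : Q) : E [⋀^Fin 2]→L[ℝ] ℝ := Ω x

/-- The differential of a chart, read in the model space. -/
def chartDeriv (e : OpenPartialHomeomorph Q E) (x : Q) : E →L[ℝ] E :=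
  mfderiv 𝓘(ℝ, E) 𝓘(ℝ, E) e x

/-- The differential of the inverse of a chart, read in the model space. -/
def chartSymmDeriv (e : OpenPartialHomeomorph Q E) (y : E) : E →L[ℝ] E :=
  mfderiv 𝓘(ℝ, E) 𝓘(ℝ, E) e.symm y

lemma comp_vecCons_pair (A : E →L[ℝ] E) (v w : E) : ⇑A ∘ ![v, w] = ![A v, A w] := by
  ext i
  fin_cases i <;> rfl

lemma TwoForm.inChart_apply (Ω : TwoForm E Q) (e : OpenPartialHomeomorph Q E) (y v w : E) :
    Ω.inChart e y ![v, w] =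
      Ω.atPoint (e.symm y) ![chartSymmDeriv e y v, chartSymmDeriv e y w] := by
  rw [← comp_vecCons_pair]
  rfl

lemma TwoForm.IsInvariant.atPoint_smul {Ω : TwoForm E Q} (h : Ω.IsInvariant Γ) (g : Γ) (x : Q)
    (v w : E) :
    Ω.atPoint (g • x) ![actionDeriv g x v, actionDeriv g x w] = Ω.atPoint x ![v, w] := by
  rw [← comp_vecCons_pair]
  exact congrArg (fun A : E [⋀^Fin 2]→L[ℝ] ℝ => A ![v, w]) (h g x)

variable {e : OpenPartialHomeomorph Q E}

variable [IsManifold 𝓘(ℝ, E) ∞ Q]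

lemma mdifferentiableAt_chart (he : e ∈ IsManifold.maximalAtlas 𝓘(ℝ, E) ∞ Q)
    {x : Q} (hx : x ∈ e.source) :
    MDifferentiableAt 𝓘(ℝ, E) 𝓘(ℝ, E) e x :=
  (contMDiffAt_of_mem_maximalAtlas he hx).mdifferentiableAt (by simp)

lemma mdifferentiableAt_chart_symm (he : e ∈ IsManifold.maximalAtlas 𝓘(ℝ, E) ∞ Q)
    {y : E} (hy : y ∈ e.target) :
    MDifferentiableAt 𝓘(ℝ, E) 𝓘(ℝ, E) e.symm y :=
  (contMDiffAt_symm_of_mem_maximalAtlas he hy).mdifferentiableAt (by simp)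

lemma chartSymmDeriv_chartDeriv (he : e ∈ IsManifold.maximalAtlas 𝓘(ℝ, E) ∞ Q)
    {x : Q} (hx : x ∈ e.source) (v : E) :
    chartSymmDeriv e (e x) (chartDeriv e x v) = v := by
  have h1 := mfderiv_comp (I := 𝓘(ℝ, E)) (I' := 𝓘(ℝ, E)) (I'' := 𝓘(ℝ, E)) x
    (mdifferentiableAt_chart_symm he (e.map_source hx)) (mdifferentiableAt_chart he hx)
  have h2 : (e.symm ∘ e : Q → Q) =ᶠ[𝓝 x] id := by
    filter_upwards [e.open_source.mem_nhds hx] with z hz using e.left_inv hz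
  have h3 : (mfderiv 𝓘(ℝ, E) 𝓘(ℝ, E) (e.symm ∘ e) x : E →L[ℝ] E) = ContinuousLinearMap.id ℝ E :=
    h2.mfderiv_eq.trans mfderiv_id
  exact congrArg (fun A : E →L[ℝ] E => A v) (h1.symm.trans h3)

/-- The tangent space at `q` is the model space through the preferred chart at `q`. The
normalization of `e` therefore makes its differential there the identity, so that the local form at
`e q` is `Ω q` itself. -/
lemma chartSymmDeriv_eq_id (he : e ∈ IsManifold.maximalAtlas 𝓘(ℝ, E) ∞ Q)
    {q : Q} (hqe : q ∈ e.source)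
    (h : fderiv ℝ (e ∘ (chartAt E q).symm) (chartAt E q q) = ContinuousLinearMap.id ℝ E) (v : E) :
    chartSymmDeriv e (e q) v = v := by
  have h1 : HasFDerivWithinAt (writtenInExtChartAt 𝓘(ℝ, E) 𝓘(ℝ, E) q e)
      (chartDeriv e q) (range 𝓘(ℝ, E)) (extChartAt 𝓘(ℝ, E) q q) :=
    (mdifferentiableAt_chart he hqe).hasMFDerivAt.2
  have h2 : HasFDerivAt (e ∘ (chartAt E q).symm) (chartDeriv e q) (chartAt E q q) := by
    simp only [mfld_simps, hasFDerivWithinAt_univ, writtenInExtChartAt] at h1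
    exact h1
  have h3 : chartDeriv e q = ContinuousLinearMap.id ℝ E := h2.fderiv.symm.trans h
  have h4 := chartSymmDeriv_chartDeriv he hqe v
  rwa [h3] at h4

/-- Obtained by inverting and differentiating `e (g • x) = A (e x)`; it transfers invariance of a
form from `Q` to its chart expression. -/
lemma chartSymmDeriv_equivariant (he : e ∈ IsManifold.maximalAtlas 𝓘(ℝ, E) ∞ Q)
    {g : Γ} {A : E →L[ℝ] E}
    (hd : MDifferentiable 𝓘(ℝ, E) 𝓘(ℝ, E) (fun y : Q => g • y))
    (hsource : ∀ x ∈ e.source, g • x ∈ e.source) (hA : ∀ x ∈ e.source, e (g • x) = A (e x))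
    {y : E} (hy : y ∈ e.target) (v : E) :
    e.symm (A y) = g • e.symm y ∧
    chartSymmDeriv e (A y) (A v) = actionDeriv g (e.symm y) (chartSymmDeriv e y v) := by
  have hpoint : ∀ z ∈ e.target, A z ∈ e.target ∧ e.symm (A z) = g • e.symm z := by
    intro z hz
    have hx := e.map_target hz
    have h1 := hA _ hx
    rw [e.right_inv hz] at h1
    rw [← h1]
    exact ⟨e.map_source (hsource _ hx), e.left_inv (hsource _ hx)⟩
  refine ⟨(hpoint y hy).2, ?_⟩
  have h1 := mfderiv_comp (I := 𝓘(ℝ, E)) (I' := 𝓘(ℝ, E)) (I'' := 𝓘(ℝ, E)) y (f := A)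
    (mdifferentiableAt_chart_symm he (hpoint y hy).1) A.differentiableAt.mdifferentiableAt
  have h2 := mfderiv_comp (I := 𝓘(ℝ, E)) (I' := 𝓘(ℝ, E)) (I'' := 𝓘(ℝ, E)) y (f := e.symm)
    (g := fun x : Q => g • x) (hd _) (mdifferentiableAt_chart_symm he hy)
  have h3 : (e.symm ∘ A : E → Q) =ᶠ[𝓝 y] (fun x : Q => g • x) ∘ e.symm := by
    filter_upwards [e.open_target.mem_nhds hy] with z hz using (hpoint z hz).2
  have h4 : (mfderiv 𝓘(ℝ, E) 𝓘(ℝ, E) A y : E →L[ℝ] E) = A :=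
    mfderiv_eq_fderiv.trans A.fderiv
  have h5 : (chartSymmDeriv e (A y)).comp (mfderiv 𝓘(ℝ, E) 𝓘(ℝ, E) A y : E →L[ℝ] E) =
      (actionDeriv g (e.symm y)).comp (chartSymmDeriv e y) :=
    h1.symm.trans (h3.mfderiv_eq.trans h2)
  rw [h4] at h5
  exact congrArg (fun B : E →L[ℝ] E => B v) h5

end Charts

end EquivariantDarboux

end

/-! ### The equivariant Darboux theorem. -/

theorem mainTheorem5
    {E : Type*} [NormedAddCommGroup E] [NormedSpace ℝ E] [FiniteDimensional ℝ E]
    {Q : Type*} [TopologicalSpace Q] [ChartedSpace E Q] [IsManifold 𝓘(ℝ, E) ∞ Q]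
    {F : Type*} [NormedAddCommGroup F] [NormedSpace ℝ F] [FiniteDimensional ℝ F]
    {Γ : Type*} [TopologicalSpace Γ] [ChartedSpace F Γ] [Group Γ] [LieGroup 𝓘(ℝ, F) ∞ Γ]
    [CompactSpace Γ] [MulAction Γ Q] [ContMDiffSMul 𝓘(ℝ, F) 𝓘(ℝ, E) ∞ Γ Q]
    (Ω : TwoForm E Q) (hΩ : Ω.IsSymplectic) (hinv : Ω.IsInvariant Γ)
    (q : Q) (hq : ∀ g : Γ, g • q = q) :
    ∃ (U : Set Q) (V : Set (TangentSpace 𝓘(ℝ, E) q))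
      (f : OpenPartialHomeomorph Q (TangentSpace 𝓘(ℝ, E) q)),
      IsOpen U ∧ q ∈ U ∧ (∀ g : Γ, ∀ x ∈ U, g • x ∈ U) ∧
      IsOpen V ∧ 0 ∈ V ∧ (∀ g : Γ, ∀ v ∈ V, linearizedAction hq g v ∈ V) ∧
      f.source = U ∧ f.target = V ∧
      IsSymplectomorphismToTangent Ω f ∧
      (∀ g : Γ, ∀ x ∈ U, f (g • x) = linearizedAction hq g (f x)) ∧
      f q = 0 := by
  have hd : ∀ g : Γ, MDifferentiable 𝓘(ℝ, E) 𝓘(ℝ, E) (fun y : Q => g • y) := fun g =>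
    ((contMDiff_smul (I := 𝓘(ℝ, F)) (I' := 𝓘(ℝ, E)) (n := ∞)).comp
      ((contMDiff_const (c := g)).prodMk contMDiff_id)).mdifferentiable (by simp)
  obtain ⟨⟨C, hC⟩, e, he, hqe, heq, heinv, heequiv, heid⟩ := exists_linearizing_chart F hq hd
  let ρ := isotropyRep hq hd
  let β : E → E →L[ℝ] E →L[ℝ] ℝ := fun y => alternatingToBilin (Ω.inChart e y)
  have h0e : (0 : E) ∈ e.target := heq ▸ e.map_source hqe
  have hsymm0 : e.symm 0 = q := by rw [← heq, e.left_inv hqe]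
  have hid : ∀ v, chartSymmDeriv e 0 v = v := fun v => by
    have := chartSymmDeriv_eq_id he hqe heid v
    rwa [heq] at this
  have hβ0 : ∀ v w, β 0 v w = Ω.atPoint q ![v, w] := fun v w => by
    change Ω.inChart e 0 ![v, w] = _
    rw [TwoForm.inChart_apply, hid, hid, hsymm0]
  have hsm : ∀ y ∈ e.target, DifferentiableAt ℝ (Ω.inChart e) y := fun y hy =>
    ((hΩ.smooth e he).contDiffAt (e.open_target.mem_nhds hy)).differentiableAt (by simp)
  obtain ⟨f, h0f, hfe, hf0, hfsm, hfsymm, hfinv, hfequiv, hfβ⟩ :=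
    exists_equivariant_moser ρ hC (β := β) e.open_target h0e
      ((alternatingToBilin (E := E)).contDiff.comp_contDiffOn (hΩ.smooth e he))
      (fun y _ v w => alternating_swap (Ω.inChart e y) v w)
      (fun y hy v₁ v₂ v₃ => by
        simp only [β, fderiv_alternatingToBilin_comp (hsm y hy)]
        exact fderiv_cyclic_of_extDeriv_eq_zero (hΩ.closed e he y hy) v₁ v₂ v₃)
      (fun v hv => hΩ.nondegenerate q v fun w => (hβ0 v w).symm.trans (hv w))
      (fun g y hy _ v w => by
        change Ω.inChart e _ ![_, _] = Ω.inChart e y ![v, w]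
        have hv := chartSymmDeriv_equivariant he (hd g) (heinv g) (heequiv g) hy v
        have hw := chartSymmDeriv_equivariant he (hd g) (heinv g) (heequiv g) hy w
        rw [TwoForm.inChart_apply, TwoForm.inChart_apply, hv.2, hw.2, hv.1, hinv.atPoint_smul])
  -- `T` is the identity, retyping the model space as the tangent space at `q`.
  let T := (tangentModel (E := E) q).symm.toHomeomorph.toOpenPartialHomeomorph
  let φ : OpenPartialHomeomorph Q (TangentSpace 𝓘(ℝ, E) q) := (e.trans f).trans T
  have hφs : φ.source = e.source ∩ e ⁻¹' f.source := by
    ext x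
    simp [φ, T]
  have hφq : q ∈ φ.source := by
    rw [hφs]
    exact ⟨hqe, by rw [mem_preimage, heq]; exact h0f⟩
  have hφ0 : φ q = 0 := by
    change f (e q) = (0 : E)
    rw [heq, hf0]
  have hφinv : ∀ g : Γ, ∀ x ∈ φ.source, g • x ∈ φ.source := by
    rw [hφs]
    intro g x hx
    refine ⟨heinv g x hx.1, ?_⟩
    rw [mem_preimage, heequiv g x hx.1]
    exact hfinv g _ hx.2
  have hφequiv : ∀ g : Γ, ∀ x ∈ φ.source, φ (g • x) = linearizedAction hq g (φ x) := by
    rw [hφs]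
    intro g x hx
    refine Eq.trans ?_ (linearizedAction_apply hq hd g _).symm
    change f (e (g • x)) = ρ g (f (e x))
    rw [heequiv g x hx.1]
    exact hfequiv g _ hx.2
  refine ⟨φ.source, φ.target, φ, φ.open_source, hφq, hφinv, φ.open_target,
    hφ0 ▸ φ.map_source hφq, ?_, rfl, rfl, ⟨?_, ?_, ?_⟩, hφequiv, hφ0⟩
  -- The target is invariant as the image of an invariant set under an equivariant map.
  · intro g v hv
    have h1 := hφequiv g _ (φ.map_target hv)
    rw [φ.right_inv hv] at h1
    rw [← h1]
    exact φ.map_source (hφinv g _ (φ.map_target hv))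
  · change ContMDiffOn 𝓘(ℝ, E) 𝓘(ℝ, E) ∞ (f ∘ e) φ.source
    rw [hφs]
    exact hfsm.contMDiffOn.comp ((contMDiffOn_of_mem_maximalAtlas he).mono inter_subset_left)
      fun x hx => hx.2
  · change ContMDiffOn 𝓘(ℝ, E) 𝓘(ℝ, E) ∞ (e.symm ∘ f.symm) _
    refine (contMDiffOn_symm_of_mem_maximalAtlas he).comp (hfsymm.contMDiffOn.mono ?_) ?_
    · intro y hy
      exact hy.2.1
    · intro y hy
      exact hy.2.2
  · rw [hφs]
    intro x hx
    have hA : (vectorDeriv φ x : E →L[ℝ] E) = (fderiv ℝ f (e x)).comp (chartDeriv e x) := by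
      have h1 := mfderiv_comp (I := 𝓘(ℝ, E)) (I' := 𝓘(ℝ, E)) (I'' := 𝓘(ℝ, E)) x (g := f) (f := e)
        ((hfsm.contDiffAt (f.open_source.mem_nhds hx.2)).differentiableAt
          (by simp)).mdifferentiableAt (mdifferentiableAt_chart he hx.1)
      rw [mfderiv_eq_fderiv] at h1
      exact h1
    refine (congrArg (fun B : E →L[ℝ] E => (Ω.atPoint q).compContinuousLinearMap B) hA).trans ?_
    change _ = Ω.atPoint x
    refine ext_pair fun v w => ?_
    rw [ContinuousAlternatingMap.compContinuousLinearMap_apply, comp_vecCons_pair]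
    have h1 := hfβ (e x) hx.2 (chartDeriv e x v) (chartDeriv e x w)
    rw [hβ0] at h1
    refine h1.trans ?_
    change Ω.inChart e _ ![_, _] = _
    rw [TwoForm.inChart_apply, chartSymmDeriv_chartDeriv he hx.1,
      chartSymmDeriv_chartDeriv he hx.1, e.left_inv hx.1]
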